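/- Let $r,s\in\mathbb N=\{1,2,\dots\}$ and put $\nu_0=1/\sqrt{rs}$, $\nu=\sqrt{r/s}$, so that $\nu=r\nu_0$ and $1/\nu=s\nu_0$. Let $\mathfrak c_n$ $(n\in\mathbb Z)$ and $R$ be the operators of the (extended) Heisenberg algebra, $[\mathfrak c_n,\mathfrak c_m]=n\delta_{n+m,0}$, $[\mathfrak c_n,R]=\delta_{n,0}R$, $\mathfrak c_n^\dagger=\mathfrak c_{-n}$, $R^\dagger=R^{-1}$, acting on the Fock space with vacuum $|0\rangle$, $\mathfrak c_n|0\rangle=0$ for $n\ge 0$ and $\langle 0|R^Q|0\rangle=\delta_{Q,0}$. Let $|Q\rangle=R^Q|0\rangle$ for $Q\in\mathbb Z$, let $\mathcal D_b$ be the space of finite linear combinations of the states $\prod_{n\ge1}\mathfrak c_{-n}^{m_n}|Q\rangle$ (with $m_n\in\mathbb N_0$, only finitely many non-zero), and let $\mathcal Q=\nu_0\mathfrak c_0$. For $\mu\in\nu_0\mathbb Z$ let $$\phi_\mu(x)=\exp\Big(-\mu\sum_{n<0}\frac{\mathfrak c_n}{n}e^{inx}\Big)\,e^{-i\mu\mathcal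 Qx/2}R^{\mu/\nu_0}e^{-i\mu\mathcal Qx/2}\,\exp\Big(-\mu\sum_{n>0}\frac{\mathfrak c_n}{n}e^{inx}\Big),$$ a quadratic form on $\mathcal D_b$, and let $$\hat\phi_\mu(n)=\int_{-\pi-i\epsilon}^{\pi-i\epsilon}e^{i\mu\mathcal Qx/2}\phi_\mu(x)e^{i\mu\mathcal Qx/2}\,e^{inx}\,dx\qquad(\epsilon>0,\ n\in\mathbb Z),$$ which does not depend on $\epsilon$ and is an operator mapping $\mathcal D_b$ to $\mathcal D_b$. For $N,M\in\mathbb N_0$, $Q\in\mathbb Z$ and $\mathbf n\in\mathbb Z^{N+M}$ define the anyon state $$\eta^{N,M}_Q(\mathbf n)=\hat\phi_\nu(n_1)\cdots\hat\phi_\nu(n_N)\,\hat\phi_{-1/\nu}(n_{N+1})\cdots\hat\phi_{-1/\nu}(n_{N+M})|Q\rangle .$$ Define the operators $$\mathcal H^{\nu,1}=\tfrac1\nu\mathcal Q,\qquad \mathcal H^{\nu,2}=\tfrac12\mathcal Q^2+\sum_{n>0}\mathfrak c_{-n}\mathfrak c_n,$$ $$\mathcal H^{\nu,3}=\frac\nu3\sum_{\substack{n,m,\ell\ne0\\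 n+m+\ell=0}}{:}\mathfrak c_n\mathfrak c_m\mathfrak c_\ell{:}+\sum_{n>0}\big[(1-\nu^2)n+2\nu\mathcal Q\big]\mathfrak c_{-n}\mathfrak c_n+\frac\nu3\mathcal Q^3-\frac{\nu^3}{12}\mathcal Q,$$ where ${:}\cdots{:}$ is normal ordering (all $\mathfrak c_n$ with $n>0$ to the right of those with $n<0$). Let $$n_j^+=\begin{cases}n_j+\nu^2(N+\frac12-j)-M+\nu\nu_0Q&(1\le j\le N),\\ n_j+\nu^{-2}(M+\frac12-(j-N))-\nu^{-1}\nu_0Q&(N+1\le j\le N+M),\end{cases}$$ $$E^{N,M}_{1,Q}=N-\nu^{-2}M+\nu^{-1}\nu_0Q,\qquad E^{N,M}_{2,Q,\mathbf n}=\sum_{j=1}^{N+M}n_j^++\tfrac12(\nu_0Q)^2,$$ $$E^{N,M}_{3,Q,\mathbf n}=\sum_{j=1}^N(n_j^+)^2-\nu^2\sum_{j=1}^M(n_{N+j}^+)^2+\tfrac1{12}(\nu^2-\nu^{-2})M+\tfrac13\nu(\nu_0Q)^3-\tfrac1{12}\nu^3\nu_0Q,$$ and, for $j<k$, $\gamma_{jk}=\nu^2(\nu^2-1)$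 if $j,k\le N$, $\gamma_{jk}=(\nu^2-1)/\nu^2$ if $j,k>N$, and $\gamma_{jk}=1-\nu^2$ otherwise. Let $\mathbf e_j$ be the standard unit vectors of $\mathbb Z^{N+M}$. **Corollary.** For all $N,M\in\mathbb N_0$, $Q\in\mathbb Z$ and $\mathbf n\in\mathbb Z^{N+M}$, $$\mathcal H^{\nu,1}\eta^{N,M}_Q(\mathbf n)=E^{N,M}_{1,Q}\,\eta^{N,M}_Q(\mathbf n),\qquad \mathcal H^{\nu,2}\eta^{N,M}_Q(\mathbf n)=E^{N,M}_{2,Q,\mathbf n}\,\eta^{N,M}_Q(\mathbf n),$$ $$\mathcal H^{\nu,3}\eta^{N,M}_Q(\mathbf n)=E^{N,M}_{3,Q,\mathbf n}\,\eta^{N,M}_Q(\mathbf n)-2\sum_{1\le j<k\le N+M}\gamma_{jk}\sum_{\mu=1}^\infty\mu\,\eta^{N,M}_Q\big(\mathbf n+\mu[\mathbf e_j-\mathbf e_k]\big),$$ where in each of the sums over $\mu$ only finitely many terms are non-zero. -/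

import Mathlib

noncomputable section

open scoped Nat ComplexConjugate

namespace Anyon

/-- Occupation numbers `𝐦 = (m₁, m₂, …)`, only finitely many of them non-zero. -/
abbrev Occ : Type := ℕ+ →₀ ℕ

/-- The space `𝒟_b` of finite boson states, in its polynomial realization: `Finsupp.single Q f` is the
state `f(𝔠₋₁, 𝔠₋₂, …) R^Q |0⟩`, the variable `X n` standing for the creation operator `𝔠₋ₙ`.
The Hilbert space is the completion of `𝒟_b`; all operators below act on `𝒟_b`. -/
abbrev Db : Type := ℤ →₀ MvPolynomial ℕ+ ℂ

/-- Let an operator on polynomials act in every charge sector. -/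
def inSectors (A : MvPolynomial ℕ+ ℂ →ₗ[ℂ] MvPolynomial ℕ+ ℂ) : Module.End ℂ Db :=
  Finsupp.mapRange.linearMap A

/-- The operator which multiplies the sector of charge `Q` by the number `w Q`. -/
def sectorMul (w : ℤ → ℂ) : Module.End ℂ Db :=
  Finsupp.lsum ℂ fun Q => w Q • Finsupp.lsingle Q

/-- The operators `𝔠ₙ`, `n ∈ ℤ`: for `n > 0`, `𝔠ₙ = n ∂/∂Xₙ` and `𝔠₋ₙ` is multiplication by `Xₙ`;
`𝔠₀` is the charge. Thus `[𝔠ₙ, 𝔠ₘ] = n δ_{n+m,0}`. -/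
def cc : ℤ → Module.End ℂ Db
  | Int.ofNat 0 => sectorMul fun Q => (Q : ℂ)
  | Int.ofNat (k + 1) => inSectors (((k : ℂ) + 1) • (MvPolynomial.pderiv k.succPNat).toLinearMap)
  | Int.negSucc k => inSectors (LinearMap.mulLeft ℂ (MvPolynomial.X k.succPNat))

/-- The charge raising operator `R`, `R (f R^Q |0⟩) = f R^(Q+1) |0⟩`, so that `[𝔠ₙ, R] = δ_{n,0} R`. -/
def raise : Db ≃ₗ[ℂ] Db := Finsupp.domLCongr (Equiv.addRight (1 : ℤ))

/-- The vacuum `|0⟩`. -/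
def vac : Db := Finsupp.single 0 1

/-- `|Q⟩ = R^Q |0⟩`. -/
def ket (Q : ℤ) : Db := (raise ^ Q) vac

/-- The squared norm `∏ₙ n^(mₙ) mₙ!` of `∏ₙ 𝔠₋ₙ^(mₙ) R^Q |0⟩`. -/
def occNormSq (m : Occ) : ℝ := m.prod fun n k => ((n : ℕ) : ℝ) ^ k * (k ! : ℝ)

/-- The inner product of `𝒟_b`, linear in the second argument. -/
def braket (v w : Db) : ℂ :=
  v.sum fun Q f => ∑ m ∈ f.support, conj (f.coeff m) * (w Q).coeff m * (occNormSq m : ℂ)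

/-- The orthonormal boson states `∏ₙ (n^(mₙ) mₙ!)^(-1/2) 𝔠₋ₙ^(mₙ) R^Q |0⟩`. -/
def etaB (Q : ℤ) (m : Occ) : Db :=
  Finsupp.single Q (MvPolynomial.monomial m ((1 / √(occNormSq m) : ℝ) : ℂ))

/-- The charge operator `𝒬 = ν₀ 𝔠₀`. -/
def chargeQ (ν₀ : ℝ) : Module.End ℂ Db := (ν₀ : ℂ) • cc 0

/-- `exp(w 𝒬)` for a complex number `w`. -/
def expQ (ν₀ : ℝ) (w : ℂ) : Module.End ℂ Db := sectorMul fun Q => Complex.exp (w * (ν₀ * Q))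

/-- The annihilation operator `∑_{n>0} aₙ 𝔠ₙ`. On each state only finitely many terms are non-zero. -/
def annih (a : ℕ+ → ℂ) (v : Db) : Db := ∑ᶠ n : ℕ+, a n • cc (n : ℕ) v

/-- `exp(∑_{n>0} aₙ 𝔠ₙ)`. On each state only finitely many terms of the exponential series
are non-zero. -/
def expAnnih (a : ℕ+ → ℂ) (v : Db) : Db := ∑ᶠ l : ℕ, ((l ! : ℂ)⁻¹) • (annih a)^[l] v

/-- The vertex operator `φ_μ(x)` with statistics parameter `μ = k ν₀`, `k ∈ ℤ`, as a quadratic form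
`⟨v | φ_μ(x) | w⟩` on `𝒟_b`:
`φ_μ(x) = exp(-μ ∑_{n<0} 𝔠ₙ e^{inx}/n) e^{-iμ𝒬x/2} R^k e^{-iμ𝒬x/2} exp(-μ ∑_{n>0} 𝔠ₙ e^{inx}/n)`.
The first factor is `exp(∑_{n>0} (μ/n) e^{-inx} 𝔠₋ₙ)`; it acts to the left as its adjoint
`exp(∑_{n>0} conj((μ/n) e^{-inx}) 𝔠ₙ)`, since `𝔠₋ₙ† = 𝔠ₙ`. -/
def phi (ν₀ : ℝ) (k : ℤ) (x : ℂ) (v w : Db) : ℂ :=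
  braket
    (expAnnih (fun n => conj ((k * ν₀ : ℂ) / (n : ℕ) * Complex.exp (-(Complex.I * (n : ℕ) * x)))) v)
    (expQ ν₀ (-(Complex.I * (k * ν₀) * x / 2)) ((raise ^ k) (expQ ν₀ (-(Complex.I * (k * ν₀) * x / 2))
      (expAnnih (fun n => -((k * ν₀ : ℂ) / (n : ℕ)) * Complex.exp (Complex.I * (n : ℕ) * x)) w))))

/-- The modified vertex operator `e^{iμ𝒬x/2} φ_μ(x) e^{iμ𝒬x/2}`, `μ = k ν₀`, as a quadratic form
on `𝒟_b`; the adjoint of `e^{z𝒬}` is `e^{conj(z)𝒬}`. -/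
def phiCheck (ν₀ : ℝ) (k : ℤ) (x : ℂ) (v w : Db) : ℂ :=
  phi ν₀ k x (expQ ν₀ (conj (Complex.I * (k * ν₀) * x / 2)) v)
    (expQ ν₀ (Complex.I * (k * ν₀) * x / 2) w)

/-- The matrix element `⟨v | φ̂_μ(n) | w⟩ = ∫_{-π-iε}^{π-iε} ⟨v | φ̌_μ(x) | w⟩ e^{inx} dx`. -/
def phiHatForm (ν₀ ε : ℝ) (k n : ℤ) (v w : Db) : ℂ :=
  ∫ t in (-Real.pi)..Real.pi,
    phiCheck ν₀ k (t - Complex.I * ε) v w * Complex.exp (Complex.I * n * (t - Complex.I * ε))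

/-- The Fourier mode `φ̂_μ(n)`, `μ = k ν₀`, as an operator on `𝒟_b`, obtained by expanding in the
orthonormal states `etaB`; on each state only finitely many matrix elements are non-zero. -/
def phiHat (ν₀ ε : ℝ) (k n : ℤ) (w : Db) : Db :=
  ∑ᶠ b : ℤ × Occ, phiHatForm ν₀ ε k n (etaB b.1 b.2) w • etaB b.1 b.2

/-- The anyon state
`φ̂_ν(n₁) ⋯ φ̂_ν(n_N) φ̂_{-1/ν}(n_{N+1}) ⋯ φ̂_{-1/ν}(n_{N+M}) |Q⟩`, where `ν = r ν₀`, `1/ν = s ν₀`. -/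
def eta (ν₀ ε : ℝ) (r s N M : ℕ) (Q : ℤ) (n : Fin (N + M) → ℤ) : Db :=
  (List.finRange (N + M)).foldr
    (fun (j : Fin (N + M)) (v : Db) => phiHat ν₀ ε (if (j : ℕ) < N then (r : ℤ) else -(s : ℤ)) (n j) v) (ket Q)

/-- Normal ordering of the product `𝔠_{n₁} 𝔠_{n₂} ⋯` of a list of operators. -/
def normalOrd : List ℤ → Module.End ℂ Db
  | [] => 1
  | n :: L =>
    if 0 < n then normalOrd L * cc n
    else if n < 0 then cc n * normalOrd L
    else (1 / 2 : ℂ) • (normalOrd L * cc n + cc n * normalOrd L)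

/-- `ℋ^{ν,1} = 𝒬 / ν`. -/
def H1 (ν₀ ν : ℝ) (v : Db) : Db := ((1 / ν : ℝ) : ℂ) • chargeQ ν₀ v

/-- `ℋ^{ν,2} = 𝒬²/2 + ∑_{n>0} 𝔠₋ₙ 𝔠ₙ`. -/
def H2 (ν₀ : ℝ) (v : Db) : Db :=
  (1 / 2 : ℂ) • chargeQ ν₀ (chargeQ ν₀ v) + ∑ᶠ n : ℕ+, cc (-(n : ℕ)) (cc (n : ℕ) v)

/-- `ℋ^{ν,3} = (ν/3) ∑_{n,m,ℓ≠0, n+m+ℓ=0} ×× 𝔠ₙ 𝔠ₘ 𝔠_ℓ ××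
  + ∑_{n>0} [(1-ν²) n + 2ν𝒬] 𝔠₋ₙ 𝔠ₙ + (ν/3) 𝒬³ - (ν³/12) 𝒬`. -/
def H3 (ν₀ ν : ℝ) (v : Db) : Db :=
  ((ν / 3 : ℝ) : ℂ) •
      ∑ᶠ p : {p : ℤ × ℤ × ℤ // p.1 ≠ 0 ∧ p.2.1 ≠ 0 ∧ p.2.2 ≠ 0 ∧ p.1 + p.2.1 + p.2.2 = 0},
        normalOrd [p.1.1, p.1.2.1, p.1.2.2] v
    + ∑ᶠ n : ℕ+, ((((1 - ν ^ 2) * (n : ℕ) : ℝ) : ℂ) • cc (-(n : ℕ)) (cc (n : ℕ) v)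
        + ((2 * ν : ℝ) : ℂ) • chargeQ ν₀ (cc (-(n : ℕ)) (cc (n : ℕ) v)))
    + ((ν / 3 : ℝ) : ℂ) • chargeQ ν₀ (chargeQ ν₀ (chargeQ ν₀ v))
    - ((ν ^ 3 / 12 : ℝ) : ℂ) • chargeQ ν₀ v

/-- The pseudo-momenta `n⁺ⱼ`. Indices run from `0` here, so that `j + 1` stands for the usual
`1, …, N + M`. -/
def nPlus (ν₀ ν : ℝ) (N M : ℕ) (Q : ℤ) (n : Fin (N + M) → ℤ) (j : Fin (N + M)) : ℝ :=
  if (j : ℕ) < N then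
    n j + ν ^ 2 * (N + 1 / 2 - (((j : ℕ) : ℝ) + 1)) - M + ν * ν₀ * Q
  else
    n j + (ν ^ 2)⁻¹ * (M + 1 / 2 - (((j : ℕ) : ℝ) + 1 - N)) - ν⁻¹ * ν₀ * Q

/-- The eigenvalue of `ℋ^{ν,1}`. -/
def E1 (ν₀ ν : ℝ) (N M : ℕ) (Q : ℤ) : ℝ := (N - (ν ^ 2)⁻¹ * M) + ν⁻¹ * ν₀ * Q

/-- The eigenvalue of `ℋ^{ν,2}`. -/
def E2 (ν₀ ν : ℝ) (N M : ℕ) (Q : ℤ) (n : Fin (N + M) → ℤ) : ℝ :=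
  ∑ j, nPlus ν₀ ν N M Q n j + 1 / 2 * (ν₀ * Q) ^ 2

/-- The diagonal coefficient of `ℋ^{ν,3}`. -/
def E3 (ν₀ ν : ℝ) (N M : ℕ) (Q : ℤ) (n : Fin (N + M) → ℤ) : ℝ :=
  ∑ j : Fin N, nPlus ν₀ ν N M Q n (Fin.castAdd M j) ^ 2
    - ν ^ 2 * ∑ j : Fin M, nPlus ν₀ ν N M Q n (Fin.natAdd N j) ^ 2
    + 1 / 12 * (ν ^ 2 - (ν ^ 2)⁻¹) * M + ν * (ν₀ * Q) ^ 3 / 3 - ν ^ 3 * ν₀ * Q / 12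

/-- `γⱼₖ` for `j < k`. -/
def gam (ν : ℝ) (N M : ℕ) (j k : Fin (N + M)) : ℝ :=
  if (j : ℕ) < N ∧ (k : ℕ) < N then ν ^ 2 * (ν ^ 2 - 1)
  else if N ≤ (j : ℕ) ∧ N ≤ (k : ℕ) then (ν ^ 2 - 1) / ν ^ 2
  else 1 - ν ^ 2

/-- `𝐧 + μ (𝐞ⱼ - 𝐞ₖ)`. -/
def shift {K : ℕ} (n : Fin K → ℤ) (μ : ℕ+) (j k : Fin K) : Fin K → ℤ :=
  n + ((μ : ℕ) : ℤ) • (Pi.single j 1 - Pi.single k 1)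

end Anyon

end

noncomputable section

open scoped Nat ComplexConjugate
open MvPolynomial

namespace Anyon

/-! In a fixed charge sector the states are polynomials in the variables `Xₗ`, and `𝔠ₗ = l ∂/∂Xₗ` is
adjoint to multiplication by `Xₗ` for the pairing `pair`. The exponentials of annihilation operators
are translations of the variables, and integration over `x` selects energies. Hence `φ̂_μ(n)` is a
charge shift combined with `mode μ n`, whose matrix elements are `2π` times those of `φ_μ(0)`
between states whose energies differ by `n` (`phiHat_single`). Two relations suffice from there on:
`[𝔠ₗ, φ̂_μ(n)] = μ φ̂_μ(n - l)` for `l ≠ 0`, and the energy `∑ 𝔠₋ₗ 𝔠ₗ` has commutator `n φ̂_μ(n)`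
with `φ̂_μ(n)`.

The heart is `pair_ham_mode`, the commutator of `ℋ^{ν,3}` with one mode. The cubic part produces
terms quadratic in the bosons. Iterating the energy commutator expresses `n² φ̂_μ(n)` through the
same terms, so they can be traded for `n²`. What remains is `∑ l 𝔠₋ₗ φ̂_μ(n - l)` with coefficient
`(νμ + 1)(μ - ν)`, which vanishes for `μ = ν` and `μ = -1/ν`, and `∑ l φ̂_μ(n + l) 𝔠ₗ` with
coefficient `2(1 - ν²)μ`, together with scalars that complete to the square in `diagTerm`.

In a product of modes, each leftover `𝔠ₗ` moves right to the vacuum and lowers the index of one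
later factor `k` by `l`, with weight `μₖ`. Induction on the number of factors (`ham_modeState`)
gives the shift sums with coefficient `2(1 - ν²)μⱼμₖ = -2γⱼₖ`. The charge present when the `j`th
factor acts turns `nⱼ` into the pseudo-momentum `nⱼ⁺`. -/

/-- The boson states of a fixed charge, as polynomials in the creation operators. -/
abbrev Poly : Type := MvPolynomial ℕ+ ℂ

/-! ### Weights, and boson operators on polynomials -/

/-- The energy `∑ₙ n mₙ` of the occupation numbers `𝐦`. -/
def wt : Occ →+ ℕ := Finsupp.weight fun l : ℕ+ => (l : ℕ)

@[simp] theorem wt_single (l : ℕ+) (k : ℕ) : wt (Finsupp.single l k) = k * l := by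
  simp [wt, Finsupp.weight_single]

theorem wt_eq_sum (m : Occ) : wt m = ∑ l ∈ m.support, m l * (l : ℕ) := by
  simp [wt, Finsupp.weight_apply, Finsupp.sum]

theorem finite_wt_eq (d : ℕ) : {m : Occ | wt m = d}.Finite := by
  have hle : ∀ m : Occ, ∀ l, m l * (l : ℕ) ≤ wt m := by
    intro m l
    by_cases h : l ∈ m.support
    · rw [wt_eq_sum]
      exact Finset.single_le_sum (f := fun l : ℕ+ => m l * (l : ℕ)) (fun _ _ => Nat.zero_le _) h
    · simp [Finsupp.notMem_support_iff.mp h]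
  -- Weight `d` forces `m l ≤ d`, and `m l = 0` for `l > d`, so `m` lies below one fixed finitely
  -- supported function. The bound `d + 1` is a harmless enlargement that stays in `ℕ+` when `d =
  -- 0`.
  refine (Set.finite_Iic (∑ l ∈ Finset.Icc (1 : ℕ+) d.succPNat, Finsupp.single l d)).subset ?_
  intro m hm
  rw [Set.mem_Iic, Finsupp.le_def]
  intro l
  have h1 := hle m l
  rw [Set.mem_ofPred_eq] at hm
  rw [hm] at h1
  by_cases h0 : m l = 0
  · simp [h0]
  have hpos : 0 < m l := Nat.pos_of_ne_zero h0
  have hl : l ∈ Finset.Icc (1 : ℕ+) d.succPNat := by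
    rw [Finset.mem_Icc]
    refine ⟨one_le, ?_⟩
    rw [← PNat.coe_le_coe, Nat.succPNat_coe]
    nlinarith
  rw [Finsupp.finsetSum_apply]
  have : (Finsupp.single l d) l ≤ ∑ i ∈ Finset.Icc (1 : ℕ+) d.succPNat, (Finsupp.single i d : Occ) l :=
    Finset.single_le_sum (f := fun i => (Finsupp.single i d : Occ) l) (fun _ _ => Nat.zero_le _) hl
  refine le_trans ?_ this
  rw [Finsupp.single_eq_same]
  have := l.pos
  nlinarith

theorem finite_wt_eq_int (d : ℤ) : {m : Occ | (wt m : ℤ) = d}.Finite := by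
  refine (finite_wt_eq d.toNat).subset fun m hm => ?_
  simp only [Set.mem_ofPred_eq] at *
  omega

/-- The annihilation operator `𝔠ₗ = l ∂/∂Xₗ` on polynomials. -/
def lower (l : ℕ+) : Poly →ₗ[ℂ] Poly := ((l : ℕ) : ℂ) • (pderiv l).toLinearMap

/-- The creation operator `𝔠₋ₗ` on polynomials. -/
def mulX (l : ℕ+) : Poly →ₗ[ℂ] Poly := LinearMap.mulLeft ℂ (X l)

/-- The substitution `Xₗ ↦ Xₗ + cₗ`. -/
def translate (c : ℕ+ → ℂ) : Poly →ₐ[ℂ] Poly := aeval fun l => X l + C (c l)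

/-- The substitution `Xₗ ↦ tˡ Xₗ`. -/
def dilate (t : ℂ) : Poly →ₐ[ℂ] Poly := aeval fun l => C (t ^ (l : ℕ)) * X l

/-- The bilinear pairing in which the monomials are orthogonal with square norms `occNormSq`. -/
def pair : Poly →ₗ[ℂ] Poly →ₗ[ℂ] ℂ :=
  (basisMonomials ℕ+ ℂ).constr ℂ fun m => (occNormSq m : ℂ) • lcoeff ℂ m

/-- The energy operator `∑ₗ 𝔠₋ₗ 𝔠ₗ`. -/
def energy : Derivation ℂ Poly Poly := mkDerivation ℂ fun l => ((l : ℕ) : ℂ) • X l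

theorem lower_apply (l : ℕ+) (f : Poly) : lower l f = ((l : ℕ) : ℂ) • pderiv l f := rfl

theorem mulX_apply (l : ℕ+) (f : Poly) : mulX l f = X l * f := rfl

theorem lower_monomial (l : ℕ+) (m : Occ) (a : ℂ) :
    lower l (monomial m a) = monomial (m - Finsupp.single l 1) ((l : ℕ) * (a * m l)) := by
  rw [lower_apply, pderiv_monomial, smul_monomial, smul_eq_mul]

theorem mulX_monomial (l : ℕ+) (m : Occ) (a : ℂ) :
    mulX l (monomial m a) = monomial (Finsupp.single l 1 + m) a := by
  rw [mulX_apply, X, monomial_mul, one_mul]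

theorem lower_mul (l : ℕ+) (f g : Poly) : lower l (f * g) = f * lower l g + g * lower l f := by
  simp only [lower_apply, Derivation.leibniz, smul_add, smul_eq_mul, mul_smul_comm]

theorem lower_comm (l k : ℕ+) (f : Poly) : lower l (lower k f) = lower k (lower l f) := by
  induction f using MvPolynomial.induction_on with
  | C a => simp [lower_apply]
  | add p q hp hq => simp only [map_add, hp, hq]
  | mul_X p i hp =>
    have h : ∀ l k : ℕ+, lower l (lower k (X i)) = 0 := by
      intro l k
      simp only [lower_apply, pderiv_X, Derivation.map_smul]
      by_cases h : i = k <;> simp [h]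
    simp only [lower_mul, map_add, h, hp]
    ring

theorem lower_translate (c : ℕ+ → ℂ) (l : ℕ+) (f : Poly) :
    lower l (translate c f) = translate c (lower l f) := by
  induction f using MvPolynomial.induction_on with
  | C a => simp [lower_apply, translate]
  | add p q hp hq => simp only [map_add, hp, hq]
  | mul_X p i hp =>
    have h : lower l (translate c (X i)) = translate c (lower l (X i)) := by
      simp only [lower_apply, translate, aeval_X, map_add, pderiv_X, pderiv_C, map_smul]
      by_cases h : i = l <;> simp [h]
    rw [map_mul, lower_mul, hp, h, lower_mul, map_add, map_mul, map_mul]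

theorem translate_mulX (c : ℕ+ → ℂ) (l : ℕ+) (f : Poly) :
    translate c (mulX l f) = mulX l (translate c f) + c l • translate c f := by
  simp [mulX_apply, translate, add_mul, C_mul']

theorem dilate_monomial (t : ℂ) (m : Occ) (a : ℂ) :
    dilate t (monomial m a) = t ^ wt m • monomial m a := by
  rw [dilate, aeval_monomial, monomial_eq, wt_eq_sum, ← Finset.prod_pow_eq_pow_sum, algebraMap_eq]
  simp only [Finsupp.prod, mul_pow, Finset.prod_mul_distrib, smul_eq_C_mul, map_prod, map_pow]
  simp only [← pow_mul, mul_comm (m _)]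
  ring

theorem lower_eq_zero {l : ℕ+} {f : Poly} (h : l ∉ f.vars) : lower l f = 0 := by
  rw [lower_apply, pderiv_eq_zero_of_notMem_vars h, smul_zero]

theorem energy_monomial (m : Occ) (a : ℂ) : energy (monomial m a) = (wt m : ℂ) • monomial m a := by
  rw [energy, mkDerivation_monomial, wt_eq_sum, Finsupp.sum]
  push_cast
  rw [Finset.sum_smul, Finset.smul_sum]
  refine Finset.sum_congr rfl fun l hl => ?_
  have h : m - Finsupp.single l 1 + Finsupp.single l 1 = m :=
    tsub_add_cancel_of_le (by simpa [Nat.one_le_iff_ne_zero] using hl)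
  rw [smul_eq_mul, mul_smul_comm, X, monomial_mul, h, smul_monomial, smul_monomial, smul_monomial]
  congr 1
  simp only [smul_eq_mul]
  ring

/-- Both sides are derivations, so it is enough to compare them on the variables of `f`; any finite
set containing these will do. -/
theorem energy_eq_sum {S : Finset ℕ+} {f : Poly} (h : f.vars ⊆ S) :
    energy f = ∑ l ∈ S, mulX l (lower l f) := by
  have key : energy f = (∑ l ∈ S, ((X l : Poly) • ((l : ℕ) : ℂ) • pderiv l :
      Derivation ℂ Poly Poly)) f := by
    refine derivation_eq_of_forall_mem_vars fun i hi => ?_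
    rw [energy, mkDerivation_X, ← Derivation.coeFnAddMonoidHom_apply, map_sum, Finset.sum_apply,
      Finset.sum_eq_single i]
    · simp
    · intro b _ hb
      simp [hb.symm]
    · intro hi'
      exact absurd (h hi) hi'
  rw [key, ← Derivation.coeFnAddMonoidHom_apply, map_sum, Finset.sum_apply]
  rfl

/-! ### The pairing and adjoints -/

theorem pair_monomial (m : Occ) (a : ℂ) (g : Poly) :
    pair (monomial m a) g = a * ((occNormSq m : ℂ) * coeff m g) := by
  have h : monomial m a = a • basisMonomials ℕ+ ℂ m := by
    rw [coe_basisMonomials, smul_monomial, smul_eq_mul, mul_one]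
  rw [h, map_smul, LinearMap.smul_apply, pair, Module.Basis.constr_basis]
  rfl

theorem bilin_ext {A B : Poly →ₗ[ℂ] Poly →ₗ[ℂ] ℂ}
    (h : ∀ m m', A (monomial m 1) (monomial m' 1) = B (monomial m 1) (monomial m' 1)) :
    A = B := by
  refine (basisMonomials ℕ+ ℂ).ext fun m => (basisMonomials ℕ+ ℂ).ext fun m' => ?_
  simpa using h m m'

theorem occNormSq_pos (m : Occ) : 0 < occNormSq m := by
  refine Finset.prod_pos fun l _ => ?_
  have := l.pos
  positivity

theorem occNormSq_add_single (m : Occ) (l : ℕ+) :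
    occNormSq (Finsupp.single l 1 + m) = (l : ℕ) * (m l + 1) * occNormSq m := by
  have h0 : ∀ i : ℕ+, ((i : ℕ) : ℝ) ^ 0 * ((0 ! : ℕ) : ℝ) = 1 := by simp
  have he : (Finsupp.single l 1 + m).erase l = m.erase l := by
    ext i
    by_cases hi : i = l
    · simp [hi]
    · simp [Finsupp.erase_ne hi]
  unfold occNormSq
  rw [← Finsupp.mul_prod_erase' m l _ h0, ← Finsupp.mul_prod_erase' (Finsupp.single l 1 + m) l _ h0,
    he]
  simp only [Finsupp.add_apply, Finsupp.single_eq_same, add_comm 1, Nat.factorial_succ, pow_succ]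
  push_cast
  ring

theorem pair_comm (f g : Poly) : pair f g = pair g f := by
  have h : pair = pair.flip := by
    refine bilin_ext fun m m' => ?_
    rw [LinearMap.flip_apply, pair_monomial, pair_monomial, coeff_monomial, coeff_monomial]
    by_cases h : m = m'
    · simp [h]
    · simp [h, Ne.symm h]
  exact LinearMap.congr_fun (LinearMap.congr_fun h f) g

/-- By bilinearity only monomials matter, and there the factor `l (mₗ + 1)` by which the square norm
grows is exactly the one produced by `l ∂/∂Xₗ`. -/
theorem pair_mulX (l : ℕ+) (f g : Poly) : pair (mulX l f) g = pair f (lower l g) := by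
  have h : pair.compl₁₂ (mulX l) LinearMap.id = pair.compl₁₂ LinearMap.id (lower l) := by
    refine bilin_ext fun m m' => ?_
    simp only [LinearMap.compl₁₂_apply, LinearMap.id_apply]
    rw [mulX_monomial, pair_monomial, pair_monomial, lower_apply, coeff_smul, coeff_pderiv,
      occNormSq_add_single, add_comm m]
    push_cast
    rw [coeff_monomial, smul_eq_mul]
    ring_nf
  exact LinearMap.congr_fun (LinearMap.congr_fun h f) g

theorem pair_lower (l : ℕ+) (f g : Poly) : pair (lower l f) g = pair f (mulX l g) := by
  rw [pair_comm, ← pair_mulX, pair_comm]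

/-- Nondegeneracy: operator identities may be checked on matrix elements, where infinite boson sums
become finite. -/
theorem eq_of_pair_eq {g h : Poly} (H : ∀ m, pair (monomial m 1) g = pair (monomial m 1) h) :
    g = h := by
  ext m
  have := H m
  rw [pair_monomial, pair_monomial, one_mul, one_mul] at this
  exact mul_left_cancel₀ (by exact_mod_cast (occNormSq_pos m).ne') this

theorem pair_dilate (t : ℂ) (f g : Poly) : pair (dilate t f) g = pair f (dilate t g) := by
  have h : pair.compl₁₂ (dilate t).toLinearMap LinearMap.id =
      pair.compl₁₂ LinearMap.id (dilate t).toLinearMap := by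
    refine bilin_ext fun m m' => ?_
    simp only [LinearMap.compl₁₂_apply, LinearMap.id_apply, AlgHom.toLinearMap_apply]
    rw [dilate_monomial, dilate_monomial, map_smul, map_smul, LinearMap.smul_apply, pair_monomial,
      coeff_monomial]
    by_cases h : m' = m
    · simp [h]
    · simp [h]
  exact LinearMap.congr_fun (LinearMap.congr_fun h f) g

/-! ### The vertex operator at `x = 0` and its Fourier modes -/

/-- The matrix elements of the vertex operator `φ_μ(0)`. -/
def vertexForm (μ : ℂ) : Poly →ₗ[ℂ] Poly →ₗ[ℂ] ℂ :=
  pair.compl₁₂ (translate fun _ => μ).toLinearMap (translate fun _ => -μ).toLinearMap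

theorem vertexForm_apply (μ : ℂ) (f g : Poly) :
    vertexForm μ f g = pair (translate (fun _ => μ) f) (translate (fun _ => -μ) g) := rfl

theorem vertexForm_mulX_left (μ : ℂ) (l : ℕ+) (f g : Poly) :
    vertexForm μ (mulX l f) g = vertexForm μ f (lower l g) + μ * vertexForm μ f g := by
  simp only [vertexForm_apply, translate_mulX, map_add, LinearMap.add_apply, pair_mulX,
    lower_translate, map_smul, LinearMap.smul_apply, smul_eq_mul]

theorem vertexForm_mulX_right (μ : ℂ) (l : ℕ+) (f g : Poly) :
    vertexForm μ f (mulX l g) = vertexForm μ (lower l f) g - μ * vertexForm μ f g := by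
  simp only [vertexForm_apply, translate_mulX, map_add, ← pair_lower,
    lower_translate, map_smul, smul_eq_mul]
  ring

/-- The Fourier mode `φ̂_μ(n)` on polynomials. -/
def mode (μ : ℂ) (n : ℤ) : Poly →ₗ[ℂ] Poly :=
  (basisMonomials ℕ+ ℂ).constr ℂ fun m => ∑ m' ∈ (finite_wt_eq_int (wt m + n)).toFinset,
    monomial m' (2 * Real.pi * vertexForm μ (monomial m' 1) (monomial m 1) / (occNormSq m' : ℂ))

theorem pair_mode_monomial (μ : ℂ) (n : ℤ) (m' m : Occ) :
    pair (monomial m' 1) (mode μ n (monomial m 1)) =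
      if (wt m' : ℤ) = wt m + n then
        2 * Real.pi * vertexForm μ (monomial m' 1) (monomial m 1) else 0 := by
  have h : mode μ n (monomial m 1) = mode μ n (basisMonomials ℕ+ ℂ m) := by
    rw [coe_basisMonomials]
  have h0 : (occNormSq m' : ℂ) ≠ 0 := by exact_mod_cast (occNormSq_pos m').ne'
  rw [h, mode, Module.Basis.constr_basis, pair_monomial, coeff_sum]
  simp only [coeff_monomial, Finset.sum_ite_eq', Set.Finite.mem_toFinset, Set.mem_ofPred_eq]
  split_ifs
  · field_simp
  · simp

theorem wt_sub_single {m : Occ} {l : ℕ+} (h : m l ≠ 0) :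
    (wt (m - Finsupp.single l 1) : ℤ) = wt m - l := by
  have h1 : m - Finsupp.single l 1 + Finsupp.single l 1 = m :=
    tsub_add_cancel_of_le (by simpa [Nat.one_le_iff_ne_zero] using h)
  have h2 := congrArg wt h1
  rw [map_add, wt_single, one_mul] at h2
  omega

/-- This is `[𝔠ₗ, φ_μ(0)] = μ φ_μ(0)` combined with the energy selection rule: adding a quantum of
energy `l` on the left lowers the transferred energy from `n` to `n - l`. -/
theorem pair_mulX_mode (μ : ℂ) (n : ℤ) (l : ℕ+) (f g : Poly) :
    pair (mulX l f) (mode μ n g) =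
      pair f (mode μ n (lower l g)) + μ * pair f (mode μ (n - l) g) := by
  have h : pair.compl₁₂ (mulX l) (mode μ n) = pair.compl₁₂ LinearMap.id (mode μ n ∘ₗ lower l) +
      μ • pair.compl₁₂ LinearMap.id (mode μ (n - l)) := by
    refine bilin_ext fun m' m => ?_
    simp only [LinearMap.compl₁₂_apply, LinearMap.id_apply, LinearMap.add_apply,
      LinearMap.smul_apply, LinearMap.comp_apply, smul_eq_mul]
    have hl : lower l (monomial m 1) =
        (((l : ℕ) : ℂ) * m l) • monomial (m - Finsupp.single l 1) 1 := by
      rw [lower_monomial, smul_monomial]; simp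
    rw [mulX_monomial, hl, map_smul, map_smul, pair_mode_monomial, pair_mode_monomial,
      pair_mode_monomial, ← mulX_monomial, vertexForm_mulX_left, hl, map_smul, map_add, wt_single]
    -- When `m l = 0` the truncated subtraction leaves `m` unchanged, so the weight does not drop;
    -- the prefactor `m l` removes that term.
    by_cases h0 : m l = 0
    · simp only [h0, Nat.cast_zero, mul_zero, zero_smul, zero_add]
      have e : (((1 * (l : ℕ) + wt m' : ℕ) : ℤ) = wt m + n) ↔ ((wt m' : ℤ) = wt m + (n - l)) := by
        push_cast; constructor <;> intro <;> linarith
      simp only [e, mul_ite, mul_zero]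
      split_ifs <;> ring
    · have e : (((1 * (l : ℕ) + wt m' : ℕ) : ℤ) = wt m + n) ↔ ((wt m' : ℤ) = wt m + (n - l)) := by
        push_cast; constructor <;> intro <;> linarith
      have e2 : ((wt m' : ℤ) = wt (m - Finsupp.single l 1) + n) ↔
          ((wt m' : ℤ) = wt m + (n - l)) := by
        rw [wt_sub_single h0]; constructor <;> intro <;> linarith
      simp only [e, e2, smul_eq_mul]
      split_ifs <;> ring
  exact LinearMap.congr_fun (LinearMap.congr_fun h f) g

theorem pair_mode_mulX (μ : ℂ) (n : ℤ) (l : ℕ+) (f g : Poly) :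
    pair f (mode μ n (mulX l g)) =
      pair (lower l f) (mode μ n g) - μ * pair f (mode μ (n + l) g) := by
  have h : pair.compl₁₂ LinearMap.id (mode μ n ∘ₗ mulX l) = pair.compl₁₂ (lower l) (mode μ n) -
      μ • pair.compl₁₂ LinearMap.id (mode μ (n + l)) := by
    refine bilin_ext fun m' m => ?_
    simp only [LinearMap.compl₁₂_apply, LinearMap.id_apply, LinearMap.sub_apply,
      LinearMap.smul_apply, LinearMap.comp_apply, smul_eq_mul]
    have hl : lower l (monomial m' 1) =
        (((l : ℕ) : ℂ) * m' l) • monomial (m' - Finsupp.single l 1) 1 := by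
      rw [lower_monomial, smul_monomial]; simp
    rw [mulX_monomial, hl, map_smul, LinearMap.smul_apply, pair_mode_monomial, pair_mode_monomial,
      pair_mode_monomial, ← mulX_monomial, vertexForm_mulX_right, hl, map_smul,
      LinearMap.smul_apply, map_add, wt_single]
    have e : ((wt m' : ℤ) = ((1 * (l : ℕ) + wt m : ℕ) : ℤ) + n) ↔
        ((wt m' : ℤ) = wt m + (n + l)) := by
      push_cast; constructor <;> intro <;> linarith
    by_cases h0 : m' l = 0
    · simp only [h0, e, Nat.cast_zero, mul_zero, zero_smul, mul_ite]
      split_ifs <;> ring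
    · have e2 : ((wt (m' - Finsupp.single l 1) : ℤ) = wt m + n) ↔
          ((wt m' : ℤ) = wt m + (n + l)) := by
        rw [wt_sub_single h0]; constructor <;> intro <;> linarith
      simp only [e, e2, smul_eq_mul]
      split_ifs <;> ring
  exact LinearMap.congr_fun (LinearMap.congr_fun h f) g

theorem pair_energy_mode (μ : ℂ) (n : ℤ) (f g : Poly) :
    pair (energy f) (mode μ n g) = pair f (mode μ n (energy g)) + n * pair f (mode μ n g) := by
  have h : pair.compl₁₂ energy.toLinearMap (mode μ n) =
      pair.compl₁₂ LinearMap.id (mode μ n ∘ₗ energy.toLinearMap) +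
      (n : ℂ) • pair.compl₁₂ LinearMap.id (mode μ n) := by
    refine bilin_ext fun m' m => ?_
    simp only [LinearMap.compl₁₂_apply, LinearMap.id_apply, LinearMap.add_apply,
      LinearMap.smul_apply, LinearMap.comp_apply, smul_eq_mul,
      Derivation.coeFn_coe]
    rw [energy_monomial, energy_monomial, map_smul, map_smul, map_smul, LinearMap.smul_apply,
      pair_mode_monomial]
    split_ifs with h
    · have : (wt m' : ℂ) = wt m + n := by exact_mod_cast h
      rw [this]
      simp only [smul_eq_mul]
      ring
    · simp
  exact LinearMap.congr_fun (LinearMap.congr_fun h f) g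

theorem pair_energy (f g : Poly) : pair (energy f) g = pair f (energy g) := by
  have h : pair.compl₁₂ energy.toLinearMap LinearMap.id =
      pair.compl₁₂ LinearMap.id energy.toLinearMap := by
    refine bilin_ext fun m' m => ?_
    simp only [LinearMap.compl₁₂_apply, LinearMap.id_apply, Derivation.coeFn_coe]
    rw [energy_monomial, energy_monomial, map_smul, map_smul, LinearMap.smul_apply, pair_monomial,
      coeff_monomial]
    by_cases h : m = m'
    · simp [h]
    · simp [h]
  exact LinearMap.congr_fun (LinearMap.congr_fun h f) g

/-- `[𝔠ₗ, φ̂_μ(n)] = μ φ̂_μ(n - l)`. -/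
theorem lower_mode (μ : ℂ) (n : ℤ) (l : ℕ+) (f : Poly) :
    lower l (mode μ n f) = mode μ n (lower l f) + μ • mode μ (n - l) f :=
  eq_of_pair_eq fun m => by
    rw [← pair_mulX, pair_mulX_mode, map_add, map_smul, smul_eq_mul]

theorem energy_mode (μ : ℂ) (n : ℤ) (f : Poly) :
    energy (mode μ n f) = mode μ n (energy f) + (n : ℂ) • mode μ n f :=
  eq_of_pair_eq fun m => by
    rw [← pair_energy, pair_energy_mode, map_add, map_smul, smul_eq_mul]

/-- Energies are nonnegative, so a mode that would remove more energy than the state has annihilates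
it. -/
theorem exists_mode_eq_zero (μ : ℂ) (f : Poly) : ∃ n₀ : ℤ, ∀ n < n₀, mode μ n f = 0 := by
  induction f using MvPolynomial.induction_on' with
  | monomial m a =>
    refine ⟨-(wt m : ℤ), fun n hn => eq_of_pair_eq fun m' => ?_⟩
    have h : monomial m a = a • monomial m (1 : ℂ) := by simp [smul_monomial]
    rw [h, map_smul, map_smul, pair_mode_monomial, if_neg (by omega)]
    simp
  | add p q hp hq =>
    obtain ⟨n₁, h₁⟩ := hp
    obtain ⟨n₂, h₂⟩ := hq
    refine ⟨min n₁ n₂, fun n hn => ?_⟩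
    rw [lt_min_iff] at hn
    rw [map_add, h₁ n hn.1, h₂ n hn.2, add_zero]

/-! ### Cutoffs and double sums -/

/-- All variables `Xₗ` of `f` have `l ≤ K`. -/
def Bounded (K : ℕ+) (f : Poly) : Prop := ∀ l, K < l → lower l f = 0

theorem Bounded.mono {K K' : ℕ+} {f : Poly} (h : Bounded K f) (hK : K ≤ K') : Bounded K' f :=
  fun l hl => h l (hK.trans_lt hl)

theorem Bounded.lower {K : ℕ+} {f : Poly} (h : Bounded K f) (a : ℕ+) : Bounded K (lower a f) :=
  fun l hl => by rw [lower_comm, h l hl, map_zero]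

theorem exists_bounded (f : Poly) : ∃ K, Bounded K f := by
  refine ⟨f.vars.sup id, fun l hl => lower_eq_zero fun hl' => ?_⟩
  exact absurd (Finset.le_sup (f := id) hl') (not_le.mpr hl)

theorem Bounded.energy_eq {K : ℕ+} {f : Poly} (h : Bounded K f) :
    energy f = ∑ l ∈ Finset.Icc 1 K, mulX l (Anyon.lower l f) := by
  rw [energy_eq_sum (S := f.vars ∪ Finset.Icc 1 K) Finset.subset_union_left]
  refine (Finset.sum_subset Finset.subset_union_right fun l _ hl => ?_).symm
  rw [h l, map_zero]
  simpa using hl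

theorem sum_Icc_add {K : ℕ+} {F : ℕ+ → ℂ} (hF : ∀ l, K < l → F l = 0) (b : ℕ+) :
    ∑ c ∈ Finset.Icc 1 K, F (b + c) = ∑ a ∈ Finset.Icc 1 K with b < a, F a := by
  have h1 : ∑ c ∈ Finset.Icc 1 K, F (b + c) = ∑ a ∈ (Finset.Icc 1 K).image (b + ·), F a :=
    (Finset.sum_image fun x _ y _ h => add_left_cancel h).symm
  rw [h1]
  symm
  refine Finset.sum_subset ?_ ?_
  · intro a ha
    simp only [Finset.mem_filter, Finset.mem_Icc] at ha
    refine Finset.mem_image.mpr ⟨a - b, ?_, PNat.add_sub_of_lt ha.2⟩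
    rw [Finset.mem_Icc]
    refine ⟨one_le, le_trans ?_ ha.1.2⟩
    have := PNat.add_sub_of_lt ha.2
    calc a - b ≤ b + (a - b) := by
          rw [← PNat.coe_le_coe, PNat.add_coe]; exact Nat.le_add_left _ _
      _ = a := this
  · intro a ha ha'
    obtain ⟨c, hc, rfl⟩ := Finset.mem_image.mp ha
    refine hF _ (not_le.mp fun hle => ha' ?_)
    exact Finset.mem_filter.mpr ⟨Finset.mem_Icc.mpr ⟨one_le, hle⟩, PNat.lt_add_right b c⟩

/-- There are `l - 1` ordered pairs of positive integers with sum `l`; pairs with sum above `K`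
contribute nothing. -/
theorem sum_sum_Icc_add {K : ℕ+} {F : ℕ+ → ℂ} (hF : ∀ l, K < l → F l = 0) :
    ∑ a ∈ Finset.Icc 1 K, ∑ b ∈ Finset.Icc 1 K, F (a + b) =
      ∑ l ∈ Finset.Icc 1 K, (((l : ℕ) : ℂ) - 1) * F l := by
  simp only [sum_Icc_add hF, Finset.sum_filter]
  rw [Finset.sum_comm]
  refine Finset.sum_congr rfl fun l hl => ?_
  have hf : (Finset.Icc 1 K).filter (· < l) = Finset.Ico 1 l := by
    ext a
    simp only [Finset.mem_filter, Finset.mem_Icc, Finset.mem_Ico] at hl ⊢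
    exact ⟨fun h => ⟨h.1.1, h.2⟩, fun h => ⟨⟨h.1, (h.2.trans_le hl.2).le⟩, h.2⟩⟩
  rw [← Finset.sum_filter, hf, Finset.sum_const, PNat.card_Ico, nsmul_eq_mul, PNat.one_coe,
    Nat.cast_pred l.pos]

/-- The pairs split into equal, first larger, and second larger, the difference serving as a new
variable. The cubic commutator yields only the two off-diagonal pieces, which is why a diagonal
correction appears there. -/
theorem sum_sum_trichotomy {K : ℕ+} {F : ℕ+ → ℕ+ → ℂ} (h1 : ∀ a b, K < a → F a b = 0)
    (h2 : ∀ a b, K < b → F a b = 0) :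
    ∑ a ∈ Finset.Icc 1 K, ∑ b ∈ Finset.Icc 1 K, F a b =
      ∑ a ∈ Finset.Icc 1 K, F a a +
      ∑ a ∈ Finset.Icc 1 K, ∑ b ∈ Finset.Icc 1 K, F (a + b) a +
      ∑ a ∈ Finset.Icc 1 K, ∑ b ∈ Finset.Icc 1 K, F a (a + b) := by
  have e1 : ∀ a, ∑ b ∈ Finset.Icc 1 K, F (a + b) a = ∑ b ∈ Finset.Icc 1 K with a < b, F b a :=
    fun a => sum_Icc_add (F := fun b => F b a) (fun l hl => h1 l a hl) a
  have e2 : ∀ a, ∑ b ∈ Finset.Icc 1 K, F a (a + b) = ∑ b ∈ Finset.Icc 1 K with a < b, F a b :=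
    fun a => sum_Icc_add (F := fun b => F a b) (fun l hl => h2 a l hl) a
  have e3 : ∑ a ∈ Finset.Icc 1 K, ∑ b ∈ Finset.Icc 1 K, F (a + b) a =
      ∑ a ∈ Finset.Icc 1 K, ∑ b ∈ Finset.Icc 1 K with b < a, F a b := by
    simp only [e1, Finset.sum_filter]
    exact Finset.sum_comm
  rw [e3, ← Finset.sum_add_distrib]
  simp only [e2]
  rw [← Finset.sum_add_distrib]
  refine Finset.sum_congr rfl fun a ha => ?_
  have e4 : F a a = ∑ b ∈ Finset.Icc 1 K with b = a, F a b := by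
    rw [Finset.sum_filter, Finset.sum_ite_eq' , if_pos ha]
  rw [e4]
  simp only [Finset.sum_filter]
  rw [← Finset.sum_add_distrib, ← Finset.sum_add_distrib]
  refine Finset.sum_congr rfl fun b _ => ?_
  rcases lt_trichotomy a b with h | h | h
  · simp [h, h.ne', h.not_gt]
  · simp [h]
  · simp [h, h.ne, h.not_gt]

/-! ### The cubic and dispersion operators -/

/-- The cubic operator `∑_{a,b ≤ K} (𝔠₋ₐ 𝔠₋ᵦ 𝔠ₐ₊ᵦ + 𝔠₋ₐ₋ᵦ 𝔠ₐ 𝔠ᵦ)`. -/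
def cubic (K : ℕ+) : Poly →ₗ[ℂ] Poly :=
  ∑ a ∈ Finset.Icc 1 K, ∑ b ∈ Finset.Icc 1 K,
    (mulX a ∘ₗ mulX b ∘ₗ lower (a + b) + mulX (a + b) ∘ₗ lower a ∘ₗ lower b)

/-- The operator `∑_{l ≤ K} l 𝔠₋ₗ 𝔠ₗ`. -/
def dispersion (K : ℕ+) : Poly →ₗ[ℂ] Poly :=
  ∑ l ∈ Finset.Icc 1 K, ((l : ℕ) : ℂ) • mulX l ∘ₗ lower l

theorem cubic_apply (K : ℕ+) (f : Poly) : cubic K f =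
    ∑ a ∈ Finset.Icc 1 K, ∑ b ∈ Finset.Icc 1 K,
      (mulX a (mulX b (lower (a + b) f)) + mulX (a + b) (lower a (lower b f))) := by
  simp [cubic, LinearMap.sum_apply]

theorem dispersion_apply (K : ℕ+) (f : Poly) : dispersion K f =
    ∑ l ∈ Finset.Icc 1 K, ((l : ℕ) : ℂ) • mulX l (lower l f) := by
  simp [dispersion, LinearMap.sum_apply]

theorem Icc_one_subset {K K' : ℕ+} (h : K ≤ K') : Finset.Icc 1 K ⊆ Finset.Icc 1 K' :=
  Finset.Icc_subset_Icc_right h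

theorem lt_of_notMem_Icc_one {K l : ℕ+} (h : l ∉ Finset.Icc 1 K) : K < l := by
  simpa using h

theorem Bounded.dispersion_eq {K K' : ℕ+} {f : Poly} (h : Bounded K f) (hK : K ≤ K') :
    dispersion K' f = dispersion K f := by
  rw [dispersion_apply, dispersion_apply]
  refine (Finset.sum_subset (Icc_one_subset hK) fun l _ hl => ?_).symm
  rw [h l (lt_of_notMem_Icc_one hl), map_zero, smul_zero]

theorem Bounded.cubic_term {K : ℕ+} {f : Poly} (h : Bounded K f) {a b : ℕ+}
    (hab : K < a ∨ K < b) :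
    mulX a (mulX b (Anyon.lower (a + b) f)) + mulX (a + b) (Anyon.lower a (Anyon.lower b f)) =
      0 := by
  have h1 : K < a + b := by
    rcases hab with h | h
    · exact h.trans (PNat.lt_add_right a b)
    · exact h.trans (PNat.lt_add_left b a)
  have h2 : Anyon.lower a (Anyon.lower b f) = 0 := by
    rcases hab with h' | h'
    · rw [lower_comm, h a h', map_zero]
    · rw [h b h', map_zero]
  rw [h _ h1, h2]
  simp

/-- Every summand with an index above `K` contains an annihilation operator killing `f`, so the
cutoff is immaterial. -/
theorem Bounded.cubic_eq {K K' : ℕ+} {f : Poly} (h : Bounded K f) (hK : K ≤ K') :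
    cubic K' f = cubic K f := by
  rw [cubic_apply, cubic_apply, ← Finset.sum_product', ← Finset.sum_product']
  refine (Finset.sum_subset (Finset.product_subset_product (Icc_one_subset hK)
    (Icc_one_subset hK)) fun p _ hp => h.cubic_term ?_).symm
  rw [Finset.mem_product, not_and_or] at hp
  exact hp.imp lt_of_notMem_Icc_one lt_of_notMem_Icc_one

/-- Taking adjoints exchanges the two kinds of cubic monomial. -/
theorem pair_cubic (K : ℕ+) (f g : Poly) : pair (cubic K f) g = pair f (cubic K g) := by
  simp only [cubic_apply, map_sum, LinearMap.sum_apply, map_add, LinearMap.add_apply, pair_mulX,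
    pair_lower]
  refine Finset.sum_congr rfl fun a _ => Finset.sum_congr rfl fun b _ => ?_
  rw [lower_comm b a, add_comm]
  congr 2
  rw [mulX_apply, mulX_apply, mulX_apply, mulX_apply]
  ring

theorem pair_dispersion (K : ℕ+) (f g : Poly) :
    pair (dispersion K f) g = pair f (dispersion K g) := by
  simp only [dispersion_apply, map_sum, LinearMap.sum_apply, map_smul, LinearMap.smul_apply,
    pair_mulX, pair_lower]

/-! ### Commutators with a mode, as matrix elements -/

section Commutator

variable (μ : ℂ) {K : ℕ+} {f g : Poly}

theorem pair_mulX_mode_sub (n : ℤ) (l : ℕ+) (f g : Poly) :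
    pair (mulX l (lower l f)) (mode μ n g) - pair f (mode μ n (mulX l (lower l g))) =
      μ * (pair (lower l f) (mode μ (n - l) g) + pair f (mode μ (n + l) (lower l g))) := by
  rw [pair_mulX_mode, pair_mode_mulX]
  ring

theorem energy_commutator (hf : Bounded K f) (hg : Bounded K g) (n : ℤ) :
    n * pair f (mode μ n g) = μ * ∑ l ∈ Finset.Icc 1 K,
      (pair (lower l f) (mode μ (n - l) g) + pair f (mode μ (n + l) (lower l g))) := by
  have h := pair_energy_mode μ n f g
  rw [hf.energy_eq, hg.energy_eq] at h
  simp only [map_sum, LinearMap.sum_apply] at h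
  rw [Finset.mul_sum]
  simp only [← pair_mulX_mode_sub, Finset.sum_sub_distrib]
  rw [h]
  ring

theorem dispersion_commutator (n : ℤ) (f g : Poly) :
    pair (dispersion K f) (mode μ n g) - pair f (mode μ n (dispersion K g)) =
      μ * (∑ l ∈ Finset.Icc 1 K, (l : ℕ) * pair (lower l f) (mode μ (n - l) g) +
        ∑ l ∈ Finset.Icc 1 K, (l : ℕ) * pair f (mode μ (n + l) (lower l g))) := by
  simp only [dispersion_apply, map_sum, LinearMap.sum_apply, map_smul, LinearMap.smul_apply]
  rw [← Finset.sum_sub_distrib, ← Finset.sum_add_distrib, Finset.mul_sum]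
  refine Finset.sum_congr rfl fun l _ => ?_
  rw [smul_eq_mul, smul_eq_mul, ← mul_sub, pair_mulX_mode_sub]
  ring

/-- Each term on the right of `energy_commutator` is again a matrix element of a mode, with index `n
- a` or `n + a`, so the relation applies a second time. Writing `n = (n - a) + a` or `n = (n + a) -
a` leaves the sums weighted by `l`. -/
theorem energy_commutator_sq (hf : Bounded K f) (hg : Bounded K g) (n : ℤ) :
    (n : ℂ) ^ 2 * pair f (mode μ n g) = μ ^ 2 * (
      ∑ a ∈ Finset.Icc 1 K, ∑ b ∈ Finset.Icc 1 K,
        pair (lower a (lower b f)) (mode μ (n - a - b) g) +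
      2 * ∑ a ∈ Finset.Icc 1 K, ∑ b ∈ Finset.Icc 1 K,
        pair (lower a f) (mode μ (n - a + b) (lower b g)) +
      ∑ a ∈ Finset.Icc 1 K, ∑ b ∈ Finset.Icc 1 K,
        pair f (mode μ (n + a + b) (lower a (lower b g)))) +
      μ * (∑ l ∈ Finset.Icc 1 K, (l : ℕ) * pair (lower l f) (mode μ (n - l) g) -
        ∑ l ∈ Finset.Icc 1 K, (l : ℕ) * pair f (mode μ (n + l) (lower l g))) := by
  have hP : ∀ a : ℕ+, (n : ℂ) * pair (lower a f) (mode μ (n - a) g) =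
      μ * (∑ b ∈ Finset.Icc 1 K, pair (lower a (lower b f)) (mode μ (n - a - b) g) +
        ∑ b ∈ Finset.Icc 1 K, pair (lower a f) (mode μ (n - a + b) (lower b g))) +
      (a : ℕ) * pair (lower a f) (mode μ (n - a) g) := by
    intro a
    have h := energy_commutator μ (hf.lower a) hg (n - a)
    simp only [Finset.sum_add_distrib, lower_comm _ a f] at h
    rw [← h]
    push_cast
    ring
  have hQ : ∀ a : ℕ+, (n : ℂ) * pair f (mode μ (n + a) (lower a g)) =
      μ * (∑ b ∈ Finset.Icc 1 K, pair (lower b f) (mode μ (n - b + a) (lower a g)) +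
        ∑ b ∈ Finset.Icc 1 K, pair f (mode μ (n + a + b) (lower a (lower b g)))) -
      (a : ℕ) * pair f (mode μ (n + a) (lower a g)) := by
    intro a
    have h := energy_commutator μ hf (hg.lower a) (n + a)
    simp only [Finset.sum_add_distrib, lower_comm _ a g, add_sub_right_comm] at h
    rw [← h]
    push_cast
    ring
  rw [pow_two, mul_assoc, energy_commutator μ hf hg, ← mul_assoc, mul_comm (n : ℂ), mul_assoc,
    Finset.mul_sum]
  simp only [mul_add (n : ℂ), hP, hQ]
  simp only [Finset.sum_add_distrib, Finset.sum_sub_distrib, mul_add, ← Finset.mul_sum]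
  rw [Finset.sum_comm (f := fun a b : ℕ+ => pair (lower b f) (mode μ (n - b + a) (lower a g)))]
  ring

/-- One contraction with the mode gives the `μ` terms, two give the `μ²` terms. The latter depend
only on `a + b`, whence the multiplicity `l - 1`; the mixed terms never have equal indices, whence
the subtracted diagonal. -/
theorem cubic_commutator (hf : Bounded K f) (hg : Bounded K g) (n : ℤ) :
    pair (cubic K f) (mode μ n g) - pair f (mode μ n (cubic K g)) =
      μ * (∑ a ∈ Finset.Icc 1 K, ∑ b ∈ Finset.Icc 1 K,
        pair (lower a (lower b f)) (mode μ (n - a - b) g) +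
      2 * ∑ a ∈ Finset.Icc 1 K, ∑ b ∈ Finset.Icc 1 K,
        pair (lower a f) (mode μ (n - a + b) (lower b g)) -
      2 * ∑ a ∈ Finset.Icc 1 K, pair (lower a f) (mode μ n (lower a g)) +
      ∑ a ∈ Finset.Icc 1 K, ∑ b ∈ Finset.Icc 1 K,
        pair f (mode μ (n + a + b) (lower a (lower b g)))) +
      μ ^ 2 * (∑ l ∈ Finset.Icc 1 K, (((l : ℕ) : ℂ) - 1) * pair (lower l f) (mode μ (n - l) g) -
        ∑ l ∈ Finset.Icc 1 K, (((l : ℕ) : ℂ) - 1) * pair f (mode μ (n + l) (lower l g))) := by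
  have ht := sum_sum_trichotomy (K := K)
    (F := fun a b => pair (lower a f) (mode μ (n - a + b) (lower b g)))
    (fun a b h => by simp [hf a h]) (fun a b h => by simp [hg b h])
  have hP := sum_sum_Icc_add (K := K) (F := fun l => pair (lower l f) (mode μ (n - l) g))
    (fun l h => by simp [hf l h])
  have hQ := sum_sum_Icc_add (K := K) (F := fun l => pair f (mode μ (n + l) (lower l g)))
    (fun l h => by simp [hg l h])
  have hterm : ∀ a b : ℕ+,
      pair (mulX a (mulX b (lower (a + b) f)) + mulX (a + b) (lower a (lower b f))) (mode μ n g) -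
        pair f (mode μ n (mulX a (mulX b (lower (a + b) g)) +
          mulX (a + b) (lower a (lower b g)))) =
      μ * pair (lower a (lower b f)) (mode μ (n - a - b) g) +
      μ * pair (lower (a + b) f) (mode μ (n - (a + b : ℕ+) + a) (lower a g)) +
      μ * pair (lower (b + a) f) (mode μ (n - (b + a : ℕ+) + b) (lower b g)) +
      μ * pair (lower a f) (mode μ (n - a + (a + b : ℕ+)) (lower (a + b) g)) +
      μ * pair (lower b f) (mode μ (n - b + (b + a : ℕ+)) (lower (b + a) g)) +
      μ * pair f (mode μ (n + a + b) (lower a (lower b g))) +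
      (μ ^ 2 * pair (lower (a + b) f) (mode μ (n - (a + b : ℕ+)) g) -
      μ ^ 2 * pair f (mode μ (n + (a + b : ℕ+)) (lower (a + b) g))) := by
    intro a b
    rw [add_comm b a]
    have e1 : n - ((a + b : ℕ+) : ℕ) + a = n - b := by push_cast; ring
    have e2 : n - ((a + b : ℕ+) : ℕ) + b = n - a := by push_cast; ring
    have e3 : n - a + ((a + b : ℕ+) : ℕ) = n + b := by push_cast; ring
    have e4 : n - b + ((a + b : ℕ+) : ℕ) = n + a := by push_cast; ring
    have e5 : n - ((a + b : ℕ+) : ℕ) = n - a - b := by push_cast; ring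
    have e6 : n + ((a + b : ℕ+) : ℕ) = n + a + b := by push_cast; ring
    rw [e1, e2, e3, e4]
    simp only [map_add, LinearMap.add_apply, pair_mulX_mode, pair_mode_mulX, e5, e6,
      lower_comm b a]
    ring
  have hswap : ∀ F : ℕ+ → ℕ+ → ℂ, ∑ a ∈ Finset.Icc 1 K, ∑ b ∈ Finset.Icc 1 K, F b a =
      ∑ a ∈ Finset.Icc 1 K, ∑ b ∈ Finset.Icc 1 K, F a b := fun F => Finset.sum_comm
  have hd : ∀ a : ℕ+, n - (a : ℕ) + (a : ℕ) = n := fun a => by ring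
  simp only [hd] at ht
  rw [ht, ← hP, ← hQ]
  simp only [cubic_apply, map_sum, LinearMap.sum_apply]
  simp only [← Finset.sum_sub_distrib, hterm]
  simp only [Finset.sum_add_distrib, Finset.sum_sub_distrib, ← Finset.mul_sum]
  -- The four mixed terms agree in pairs under `a ↔ b`, which accounts for the factor `2`.
  rw [hswap fun a b => pair (lower (a + b) f) (mode μ (n - (a + b : ℕ+) + a) (lower a g)),
    hswap fun a b => pair (lower a f) (mode μ (n - a + (a + b : ℕ+)) (lower (a + b) g))]
  ring

end Commutator

/-! ### The third Hamiltonian and one mode -/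

/-- The operator `ℋ^{ν,3}` in the sector in which `𝒬` has the value `q`, on polynomials in the
variables `Xₗ` with `l ≤ K`. -/
def ham (ν q : ℂ) (K : ℕ+) : Poly →ₗ[ℂ] Poly :=
  ν • cubic K + (1 - ν ^ 2) • dispersion K + (2 * ν * q) • energy.toLinearMap +
    (ν / 3 * q ^ 3 - ν ^ 3 / 12 * q) • LinearMap.id

theorem ham_apply (ν q : ℂ) (K : ℕ+) (f : Poly) : ham ν q K f =
    ν • cubic K f + (1 - ν ^ 2) • dispersion K f + (2 * ν * q) • energy f +
      (ν / 3 * q ^ 3 - ν ^ 3 / 12 * q) • f := rfl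

theorem Bounded.ham_eq {K K' : ℕ+} {f : Poly} (h : Bounded K f) (hK : K ≤ K') (ν q : ℂ) :
    ham ν q K' f = ham ν q K f := by
  rw [ham_apply, ham_apply, h.cubic_eq hK, h.dispersion_eq hK]

theorem pair_ham (ν q : ℂ) (K : ℕ+) (f g : Poly) : pair (ham ν q K f) g = pair f (ham ν q K g) := by
  simp only [ham_apply, map_add, map_smul, LinearMap.add_apply, LinearMap.smul_apply, pair_cubic,
    pair_dispersion, pair_energy]

/-- The diagonal term in the commutator of `ℋ^{ν,3}` and `φ̂_μ(n)`, `q` being the value of `𝒬` after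
the action of `φ̂_μ(n)`. -/
def diagTerm (ν μ q : ℂ) (n : ℤ) : ℂ :=
  ν / μ * (n + μ * q - μ ^ 2 / 2) ^ 2 + ν * μ * (μ ^ 2 - ν ^ 2) / 12

/-- The hypothesis `h` is the vanishing of the coefficient of `∑ l 𝔠₋ₗ φ̂_μ(n - l)`. The diagonal
correction of the cubic commutator is cancelled because `2ν𝒬` jumps by `2νμ` across the mode. The
constant `νμ(μ² - ν²)/12` is what remains of the jump of `ν𝒬³/3 - ν³𝒬/12` after the square is
completed. -/
theorem pair_ham_mode {ν μ : ℂ} (hμ : μ ≠ 0) (h : (ν * μ + 1) * (μ - ν) = 0) (q : ℂ) {K : ℕ+}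
    {f g : Poly} (hf : Bounded K f) (hg : Bounded K g) (n : ℤ) :
    pair (ham ν (q + μ) K f) (mode μ n g) = pair f (mode μ n (ham ν q K g)) +
      diagTerm ν μ (q + μ) n * pair f (mode μ n g) +
      2 * (1 - ν ^ 2) * μ * ∑ l ∈ Finset.Icc 1 K,
        ((l : ℕ) : ℂ) * pair f (mode μ (n + l) (lower l g)) := by
  have hE : pair f (mode μ n (energy g)) =
      ∑ l ∈ Finset.Icc 1 K, pair (lower l f) (mode μ n (lower l g)) -
        μ * ∑ l ∈ Finset.Icc 1 K, pair f (mode μ (n + l) (lower l g)) := by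
    rw [hg.energy_eq]
    simp only [map_sum, pair_mode_mulX, Finset.sum_sub_distrib, ← Finset.mul_sum]
  have hE' := pair_energy_mode μ n f g
  have h1 := energy_commutator μ hf hg n
  have h2 := energy_commutator_sq μ hf hg n
  have hc := cubic_commutator μ hf hg n
  have hd := dispersion_commutator μ (K := K) n f g
  simp only [ham_apply, map_add, map_smul, LinearMap.add_apply, LinearMap.smul_apply, smul_eq_mul]
  simp only [sub_one_mul, Finset.sum_sub_distrib, Finset.sum_add_distrib] at hc h1
  have hρ : ν / μ * μ = ν := div_mul_cancel₀ ν hμ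
  rw [diagTerm]
  -- Substituting `ν = ρ μ` removes the division and leaves a polynomial identity.
  generalize ν / μ = ρ at hρ ⊢
  subst hρ
  -- The multiple `-ρ` of `h2` trades the quadratic boson terms for `n²`; `hE` and `h1` turn the
  -- unweighted first-order sums into a multiple of `n`.
  linear_combination (ρ * μ) * hc + (1 - (ρ * μ) ^ 2) * hd + 2 * (ρ * μ) * (q + μ) * hE' +
    2 * (ρ * μ) * μ * hE + (ρ * μ) * μ * h1 - ρ * h2 +
    (∑ l ∈ Finset.Icc 1 K, ((l : ℕ) : ℂ) * pair (lower l f) (mode μ (n - l) g) -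
      ∑ l ∈ Finset.Icc 1 K, ((l : ℕ) : ℂ) * pair f (mode μ (n + l) (lower l g))) * h

/-- Nondegeneracy turns the matrix-element identity into one of operators. A test monomial may
involve variables above `K`, so the cutoff is raised to cover it and then lowered again. -/
theorem ham_mode {ν μ : ℂ} (hμ : μ ≠ 0) (h : (ν * μ + 1) * (μ - ν) = 0) (q : ℂ) {K : ℕ+}
    {g : Poly} (hg : Bounded K g) (n : ℤ) (hg' : Bounded K (mode μ n g)) :
    ham ν (q + μ) K (mode μ n g) = mode μ n (ham ν q K g) +
      diagTerm ν μ (q + μ) n • mode μ n g +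
      (2 * (1 - ν ^ 2) * μ) • ∑ l ∈ Finset.Icc 1 K,
        ((l : ℕ) : ℂ) • mode μ (n + l) (lower l g) := by
  refine eq_of_pair_eq fun m => ?_
  obtain ⟨K₀, h₀⟩ := exists_bounded (monomial m 1)
  have hK : K ≤ max K K₀ := le_max_left _ _
  have hs : ∑ l ∈ Finset.Icc 1 K, ((l : ℕ) : ℂ) • mode μ (n + l) (lower l g) =
      ∑ l ∈ Finset.Icc 1 (max K K₀), ((l : ℕ) : ℂ) • mode μ (n + l) (lower l g) := by
    refine Finset.sum_subset (Icc_one_subset hK) fun l _ hl => ?_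
    rw [hg l (lt_of_notMem_Icc_one hl), map_zero, smul_zero]
  rw [← hg'.ham_eq hK, ← pair_ham, pair_ham_mode hμ h q (h₀.mono (le_max_right _ _)) (hg.mono hK),
    hg.ham_eq hK, hs]
  simp only [map_add, map_smul, map_sum, smul_eq_mul]

/-! ### From `𝒟_b` to polynomials -/

theorem inSectors_apply (A : Poly →ₗ[ℂ] Poly) (v : Db) (Q : ℤ) : inSectors A v Q = A (v Q) := by
  simp [inSectors]

theorem inSectors_single (A : Poly →ₗ[ℂ] Poly) (Q : ℤ) (f : Poly) :
    inSectors A (Finsupp.single Q f) = Finsupp.single Q (A f) := by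
  simp [inSectors]

theorem sectorMul_single (w : ℤ → ℂ) (Q : ℤ) (f : Poly) :
    sectorMul w (Finsupp.single Q f) = Finsupp.single Q (w Q • f) := by
  simp [sectorMul]

theorem sectorMul_apply (w : ℤ → ℂ) (v : Db) (Q : ℤ) : sectorMul w v Q = w Q • v Q := by
  induction v using Finsupp.induction_linear with
  | zero => simp
  | add v w hv hw => simp [hv, hw]
  | single Q' f =>
    rw [sectorMul_single]
    by_cases h : Q' = Q
    · simp [h]
    · simp [h]

theorem cc_pos (l : ℕ+) : cc ((l : ℕ) : ℤ) = inSectors (lower l) := by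
  obtain ⟨k, rfl⟩ : ∃ k : ℕ, l = k.succPNat := ⟨l.natPred, (PNat.succPNat_natPred l).symm⟩
  change inSectors (((k : ℂ) + 1) • (pderiv k.succPNat).toLinearMap) = _
  rw [lower, Nat.succPNat_coe]
  push_cast
  rfl

theorem cc_neg (l : ℕ+) : cc (-((l : ℕ) : ℤ)) = inSectors (mulX l) := by
  obtain ⟨k, rfl⟩ : ∃ k : ℕ, l = k.succPNat := ⟨l.natPred, (PNat.succPNat_natPred l).symm⟩
  rfl

theorem chargeQ_single (ν₀ : ℝ) (Q : ℤ) (f : Poly) :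
    chargeQ ν₀ (Finsupp.single Q f) = ((ν₀ : ℂ) * Q) • Finsupp.single Q f := by
  have h : cc 0 = sectorMul fun Q => (Q : ℂ) := rfl
  rw [chargeQ, LinearMap.smul_apply, h, sectorMul_single, ← Finsupp.smul_single, smul_smul]

theorem expQ_apply (ν₀ : ℝ) (w : ℂ) (v : Db) (Q : ℤ) :
    expQ ν₀ w v Q = Complex.exp (w * (ν₀ * Q)) • v Q := sectorMul_apply _ v Q

theorem raise_apply (v : Db) (Q : ℤ) : raise v Q = v (Q - 1) := by
  simp [raise, Finsupp.domLCongr_apply, sub_eq_add_neg]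

theorem raise_zpow_apply (k : ℤ) (v : Db) (Q : ℤ) : (raise ^ k) v Q = v (Q - k) := by
  induction k using Int.induction_on generalizing v with
  | zero => simp
  | succ k ih =>
    rw [zpow_add_one, LinearEquiv.mul_apply, ih, raise_apply]
    congr 1
    ring
  | pred k ih =>
    have h : v = raise (raise⁻¹ v) := by
      rw [← LinearEquiv.mul_apply, mul_inv_cancel]
      rfl
    rw [zpow_sub_one, LinearEquiv.mul_apply, ih]
    conv_rhs => rw [h, raise_apply]
    congr 1
    ring

theorem ket_eq (Q : ℤ) : ket Q = Finsupp.single Q 1 := by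
  ext1 Q'
  rw [ket, raise_zpow_apply, vac, Finsupp.single_apply, Finsupp.single_apply]
  congr 1
  exact propext ⟨fun h => by omega, fun h => by omega⟩

/-! ### Exponentials of annihilation operators -/

/-- The derivation `∑ₗ cₗ ∂/∂Xₗ`. -/
def constDer (c : ℕ+ → ℂ) : Derivation ℂ Poly Poly := mkDerivation ℂ fun l => C (c l)

theorem constDer_eq_sum (a : ℕ+ → ℂ) {S : Finset ℕ+} {f : Poly} (h : f.vars ⊆ S) :
    constDer (fun l => a l * (l : ℕ)) f = ∑ l ∈ S, a l • lower l f := by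
  have key : constDer (fun l => a l * (l : ℕ)) f = (∑ l ∈ S, (a l • ((l : ℕ) : ℂ) • pderiv l :
      Derivation ℂ Poly Poly)) f := by
    refine derivation_eq_of_forall_mem_vars fun i hi => ?_
    rw [constDer, mkDerivation_X, ← Derivation.coeFnAddMonoidHom_apply, map_sum, Finset.sum_apply,
      Finset.sum_eq_single i]
    · simp [← C_mul']
    · intro b _ hb
      simp [hb.symm]
    · intro hi'
      exact absurd (h hi) hi'
  rw [key, ← Derivation.coeFnAddMonoidHom_apply, map_sum, Finset.sum_apply]
  rfl

theorem annih_apply (a : ℕ+ → ℂ) (v : Db) (Q : ℤ) :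
    annih a v Q = constDer (fun l => a l * (l : ℕ)) (v Q) := by
  set S : Finset ℕ+ := v.support.biUnion fun Q => (v Q).vars with hS
  have h : ∀ Q, (v Q).vars ⊆ S := by
    intro Q
    by_cases hQ : Q ∈ v.support
    · exact Finset.subset_biUnion_of_mem (fun Q => (v Q).vars) hQ
    · simp [Finsupp.notMem_support_iff.mp hQ]
  rw [annih, finsum_eq_sum_of_support_subset (s := S), Finsupp.finsetSum_apply,
    constDer_eq_sum a (h Q)]
  · simp only [Finsupp.smul_apply, cc_pos, inSectors_apply]
  · intro l hl
    by_contra hl'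
    refine hl ?_
    have : cc ((l : ℕ) : ℤ) v = 0 := by
      ext1 Q
      rw [cc_pos, inSectors_apply, lower_eq_zero fun h' => hl' (h Q h')]
      rfl
    simp [this]

theorem iterate_constDer_mul_X (c : ℕ+ → ℂ) (p : Poly) (i : ℕ+) (l : ℕ) :
    (constDer c)^[l + 1] (p * X i) =
      (constDer c)^[l + 1] p * X i + ((l + 1 : ℂ) * c i) • (constDer c)^[l] p := by
  induction l with
  | zero => simp [constDer, Derivation.leibniz, mkDerivation_X, ← C_mul', mul_comm, add_comm]
  | succ l ih =>
    rw [Function.iterate_succ_apply', ih, map_add, Derivation.map_smul, Derivation.leibniz,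
      ← Function.iterate_succ_apply' (constDer c), ← Function.iterate_succ_apply' (constDer c)]
    rw [constDer, mkDerivation_X, ← constDer, smul_eq_mul, smul_eq_mul, mul_comm _ (C (c i)),
      C_mul', mul_comm (X i)]
    push_cast
    module

/-- Taylor's formula: a constant vector field is nilpotent on each polynomial, and its exponential
is translation. The product step uses that the field maps `Xᵢ` to a constant, so its iterates on `p
Xᵢ` have only two terms. -/
theorem exp_constDer (c : ℕ+ → ℂ) (f : Poly) : ∃ L : ℕ, ∀ L', L ≤ L' →
    (constDer c)^[L'] f = 0 ∧
      ∑ l ∈ Finset.range L', ((l ! : ℂ)⁻¹) • (constDer c)^[l] f = translate c f := by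
  suffices h : ∃ L : ℕ, (∀ l, L ≤ l → (constDer c)^[l] f = 0) ∧
      ∑ l ∈ Finset.range L, ((l ! : ℂ)⁻¹) • (constDer c)^[l] f = translate c f by
    obtain ⟨L, h1, h2⟩ := h
    refine ⟨L, fun L' hL => ⟨h1 L' hL, ?_⟩⟩
    rw [← h2]
    refine (Finset.sum_subset (Finset.range_mono hL) fun l _ hl => ?_).symm
    rw [h1 l (by simpa using hl), smul_zero]
  have hext : ∀ (p : Poly) (L L' : ℕ), L ≤ L' → (∀ l, L ≤ l → (constDer c)^[l] p = 0) →
      ∑ l ∈ Finset.range L', ((l ! : ℂ)⁻¹) • (constDer c)^[l] p =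
        ∑ l ∈ Finset.range L, ((l ! : ℂ)⁻¹) • (constDer c)^[l] p := by
    intro p L L' hL h1
    refine (Finset.sum_subset (Finset.range_mono hL) fun l _ hl => ?_).symm
    rw [h1 l (by simpa using hl), smul_zero]
  induction f using MvPolynomial.induction_on with
  | C a =>
    refine ⟨1, fun l hl => ?_, ?_⟩
    · obtain ⟨l, rfl⟩ := Nat.exists_eq_add_of_le' hl
      rw [Function.iterate_succ_apply, derivation_C, iterate_map_zero]
    · simp [translate]
  | add p q hp hq =>
    obtain ⟨L₁, h1, h1'⟩ := hp
    obtain ⟨L₂, h2, h2'⟩ := hq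
    refine ⟨max L₁ L₂, fun l hl => ?_, ?_⟩
    · rw [iterate_map_add, h1 l (le_trans (le_max_left _ _) hl),
        h2 l (le_trans (le_max_right _ _) hl), add_zero]
    · simp only [iterate_map_add, smul_add, Finset.sum_add_distrib]
      rw [hext p _ _ (le_max_left L₁ L₂) h1, hext q _ _ (le_max_right L₁ L₂) h2, h1', h2', map_add]
  | mul_X p i hp =>
    obtain ⟨L, h1, h1'⟩ := hp
    refine ⟨L + 1, fun l hl => ?_, ?_⟩
    · obtain ⟨l, rfl⟩ : ∃ l', l = l' + 1 := ⟨l - 1, by omega⟩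
      rw [iterate_constDer_mul_X, h1 _ (by omega), h1 _ (by omega)]
      simp
    · have h3 := hext p L (L + 1) (Nat.le_succ L) h1
      rw [Finset.sum_range_succ'] at h3 ⊢
      simp only [iterate_constDer_mul_X, smul_add, Finset.sum_add_distrib]
      -- The factor `l + 1` from the iterated Leibniz rule reduces `1/(l+1)!` to `1/l!`, reproducing
      -- the series for `p`.
      have h4 : ∀ l : ℕ, (((l + 1)! : ℂ)⁻¹) • ((l + 1 : ℂ) * c i) • (constDer c)^[l] p =
          c i • (l ! : ℂ)⁻¹ • (constDer c)^[l] p := by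
        intro l
        have : (l ! : ℂ) ≠ 0 := by exact_mod_cast l.factorial_ne_zero
        have : (l + 1 : ℂ) ≠ 0 := by exact_mod_cast l.succ_ne_zero
        rw [smul_smul, smul_smul, Nat.factorial_succ]
        congr 1
        push_cast
        field_simp
      simp only [h4]
      rw [← Finset.smul_sum, h1']
      have h5 : translate c (p * X i) = translate c p * X i + c i • translate c p := by
        simp [translate, mul_add, C_mul', mul_comm _ (C (c i))]
      rw [h5, ← h1', ← h3, add_mul, Finset.sum_mul]
      simp only [smul_mul_assoc, Function.iterate_zero, id_eq]
      abel

theorem expAnnih_apply (a : ℕ+ → ℂ) (v : Db) (Q : ℤ) :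
    expAnnih a v Q = translate (fun l => a l * (l : ℕ)) (v Q) := by
  choose L hL using fun Q => exp_constDer (fun l => a l * (l : ℕ)) (v Q)
  set L₀ := v.support.sup L
  have hit : ∀ l Q, ((annih a)^[l] v) Q = (constDer fun l => a l * (l : ℕ))^[l] (v Q) := by
    intro l Q
    induction l with
    | zero => rfl
    | succ l ih => rw [Function.iterate_succ_apply', Function.iterate_succ_apply', annih_apply, ih]
  rw [expAnnih, finsum_eq_sum_of_support_subset (s := Finset.range L₀), Finsupp.finsetSum_apply]
  · simp only [Finsupp.smul_apply, hit]
    by_cases hQ : Q ∈ v.support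
    · exact (hL Q L₀ (Finset.le_sup hQ)).2
    · rw [Finsupp.notMem_support_iff.mp hQ]
      simp [iterate_map_zero]
  · intro l hl
    by_contra hl'
    refine hl ?_
    have : (annih a)^[l] v = 0 := by
      ext1 Q
      rw [hit]
      by_cases hQ : Q ∈ v.support
      · exact (hL Q l ((Finset.le_sup hQ).trans (not_lt.mp fun h => hl' (Finset.mem_coe.mpr (Finset.mem_range.mpr h))))).1
      · rw [Finsupp.notMem_support_iff.mp hQ, iterate_map_zero]
        rfl
    simp [this]

/-! ### Vertex operators and Fourier modes on `𝒟_b` -/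

/-- The inner product is sesquilinear and `pair` bilinear; conjugating coefficients links them, and
this conjugation later cancels the one in `phi` that comes from taking an adjoint. -/
theorem braket_single (Q : ℤ) (f : Poly) (u : Db) :
    braket (Finsupp.single Q f) u = pair (MvPolynomial.map (starRingEnd ℂ) f) (u Q) := by
  rw [braket, Finsupp.sum_single_index (by simp)]
  conv_rhs => rw [f.as_sum]
  simp only [map_sum, LinearMap.sum_apply, map_monomial, pair_monomial]
  exact Finset.sum_congr rfl fun m _ => by ring

theorem map_conj_translate (c : ℕ+ → ℂ) (f : Poly) :
    MvPolynomial.map (starRingEnd ℂ) (translate (fun l => conj (c l)) f) =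
      translate c (MvPolynomial.map (starRingEnd ℂ) f) := by
  induction f using MvPolynomial.induction_on with
  | C a => simp [translate]
  | add p q hp hq => simp only [map_add, hp, hq]
  | mul_X p i hp =>
    rw [map_mul, map_mul, map_mul, map_mul, hp]
    simp [translate]

theorem translate_pow (μ t : ℂ) (ht : t ≠ 0) (f : Poly) :
    translate (fun l => μ * t ^ (l : ℕ)) f =
      dilate t⁻¹ (translate (fun _ => μ) (dilate t f)) := by
  have h : translate (fun l => μ * t ^ (l : ℕ)) =
      ((dilate t⁻¹).comp (translate fun _ => μ)).comp (dilate t) := by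
    refine MvPolynomial.algHom_ext fun l => ?_
    have : (C (t ^ (l : ℕ)) * C (t⁻¹ ^ (l : ℕ)) : Poly) = 1 := by
      rw [← C_mul, ← mul_pow, mul_inv_cancel₀ ht, one_pow, C_1]
    simp only [translate, dilate, aeval_X, AlgHom.comp_apply, map_mul, map_add, algHom_C,
      algebraMap_eq, mul_add, ← mul_assoc, this]
    ring
  rw [h]
  rfl

theorem dilate_dilate_inv (t : ℂ) (ht : t ≠ 0) (f : Poly) : dilate t (dilate t⁻¹ f) = f := by
  have h : (dilate t).comp (dilate t⁻¹) = AlgHom.id ℂ Poly := by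
    refine MvPolynomial.algHom_ext fun l => ?_
    simp only [dilate, aeval_X, AlgHom.comp_apply, map_mul, algHom_C, algebraMap_eq, ← mul_assoc,
      ← C_mul, ← mul_pow, inv_mul_cancel₀ ht, one_pow, C_1, one_mul, AlgHom.id_apply]
  exact DFunLike.congr_fun h f

/-- With `z = e^{ix}`, the vertex operator at `x` is the one at `0` conjugated by dilations, i.e. by
the energy flow. The two inner dilations meet, since `dilate` is symmetric for `pair`, and cancel.
-/
theorem pair_translate_pow (μ z : ℂ) (hz : z ≠ 0) (f g : Poly) :
    pair (translate (fun l => μ * z⁻¹ ^ (l : ℕ)) f) (translate (fun l => -μ * z ^ (l : ℕ)) g) =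
      vertexForm μ (dilate z⁻¹ f) (dilate z g) := by
  rw [translate_pow μ z⁻¹ (inv_ne_zero hz), translate_pow (-μ) z hz, inv_inv, pair_dilate,
    dilate_dilate_inv z hz, vertexForm_apply]

theorem phiCheck_etaB (ν₀ : ℝ) (k : ℤ) (x : ℂ) (Q : ℤ) (m : Occ) (w : Db) :
    phiCheck ν₀ k x (etaB Q m) w = ((1 / √(occNormSq m) : ℝ) : ℂ) *
      vertexForm (k * ν₀) (dilate (Complex.exp (Complex.I * x))⁻¹ (monomial m 1))
        (dilate (Complex.exp (Complex.I * x)) (w (Q - k))) := by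
  set z := Complex.exp (Complex.I * x) with hz
  have hz0 : z ≠ 0 := Complex.exp_ne_zero _
  set r : ℂ := ((1 / √(occNormSq m) : ℝ) : ℂ) with hr
  have hexp : expQ ν₀ (conj (Complex.I * (k * ν₀) * x / 2)) (etaB Q m) =
      Finsupp.single Q (monomial m
        (Complex.exp (conj (Complex.I * (k * ν₀) * x / 2) * (ν₀ * Q)) * r)) := by
    rw [expQ, etaB, sectorMul_single, smul_monomial, smul_eq_mul]
  have h1 : ∀ a : ℕ+ → ℂ, ∀ f, expAnnih a (Finsupp.single Q f) =
      Finsupp.single Q (translate (fun l => a l * (l : ℕ)) f) := by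
    intro a f
    ext1 Q'
    rw [expAnnih_apply]
    by_cases h : Q = Q'
    · subst h; simp
    · simp [h]
  have hn : ∀ l : ℕ+, ((l : ℕ) : ℂ) ≠ 0 := fun l => by exact_mod_cast l.ne_zero
  have e1 : (fun l : ℕ+ => conj ((k * ν₀ : ℂ) / (l : ℕ) *
      Complex.exp (-(Complex.I * (l : ℕ) * x))) * ((l : ℕ) : ℂ)) =
      fun l : ℕ+ => conj ((k * ν₀ : ℂ) * z⁻¹ ^ (l : ℕ)) := by
    funext l
    have : ((l : ℕ) : ℂ) = conj ((l : ℕ) : ℂ) := (Complex.conj_natCast _).symm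
    conv_lhs => rw [this]
    rw [← map_mul, hz, ← Complex.exp_neg, ← Complex.exp_nat_mul]
    have h := hn l
    have e : -(Complex.I * (l : ℕ) * x) = (l : ℕ) * -(Complex.I * x) := by ring
    rw [Complex.conj_natCast, e]
    congr 1
    field_simp
  have e2 : (fun l : ℕ+ => -((k * ν₀ : ℂ) / (l : ℕ)) *
      Complex.exp (Complex.I * (l : ℕ) * x) * ((l : ℕ) : ℂ)) =
      fun l : ℕ+ => -(k * ν₀ : ℂ) * z ^ (l : ℕ) := by
    funext l
    rw [hz, ← Complex.exp_nat_mul]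
    have h := hn l
    have e : Complex.I * (l : ℕ) * x = (l : ℕ) * (Complex.I * x) := by ring
    rw [e]
    field_simp
  rw [phiCheck, phi, hexp, h1, braket_single, e1, map_conj_translate, map_monomial]
  simp only [expQ_apply, raise_zpow_apply, expAnnih_apply, e2]
  have hmr : ∀ a : ℂ, monomial m a = a • monomial m (1 : ℂ) := fun a => by simp [smul_monomial]
  rw [hmr, ← pair_translate_pow _ _ hz0]
  simp only [map_smul, LinearMap.smul_apply, smul_eq_mul]
  rw [map_mul, hr, Complex.conj_ofReal, ← Complex.exp_conj, map_mul, Complex.conj_conj]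
  have hq : conj ((ν₀ : ℂ) * Q) = ν₀ * Q := by simp
  rw [hq, ← hr]
  -- The charge exponentials of the modified operator cancel those inside `phi`, in charge `Q` after
  -- raising and `Q - k` before. This makes the modes independent of the charge.
  have hone : Complex.exp (Complex.I * (k * ν₀) * x / 2 * (ν₀ * Q)) *
      (Complex.exp (-(Complex.I * (k * ν₀) * x / 2) * (ν₀ * Q)) *
      (Complex.exp (-(Complex.I * (k * ν₀) * x / 2) * (ν₀ * ((Q - k : ℤ) : ℂ))) *
      Complex.exp (Complex.I * (k * ν₀) * x / 2 * (ν₀ * ((Q - k : ℤ) : ℂ))))) = 1 := by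
    rw [← Complex.exp_add, ← Complex.exp_add, ← Complex.exp_add, ← Complex.exp_zero]
    congr 1
    ring
  linear_combination (r * pair (translate (fun l => (k * ν₀ : ℂ) * z⁻¹ ^ (l : ℕ)) (monomial m 1))
    (translate (fun l => -(k * ν₀ : ℂ) * z ^ (l : ℕ)) (w (Q - k)))) * hone

theorem integral_exp_int (ε : ℝ) (j : ℤ) :
    ∫ t in (-Real.pi)..Real.pi, Complex.exp (Complex.I * j * (t - Complex.I * ε)) =
      if j = 0 then 2 * (Real.pi : ℂ) else 0 := by
  split_ifs with h
  · subst h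
    simp
    ring
  · have hc : Complex.I * (j : ℂ) ≠ 0 := mul_ne_zero Complex.I_ne_zero (by exact_mod_cast h)
    have e : ∀ t : ℝ, Complex.exp (Complex.I * j * (t - Complex.I * ε)) =
        Complex.exp (j * ε) * Complex.exp (Complex.I * j * t) := by
      intro t
      rw [← Complex.exp_add]
      congr 1
      linear_combination (-(j : ℂ) * ε) * Complex.I_sq
    simp only [e]
    rw [intervalIntegral.integral_const_mul, integral_exp_mul_complex hc]
    have e2 : Complex.exp (Complex.I * j * (Real.pi : ℝ)) =
        Complex.exp (Complex.I * j * ((-Real.pi : ℝ) : ℂ)) := by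
      rw [Complex.exp_eq_exp_iff_exists_int]
      exact ⟨j, by push_cast; ring⟩
    rw [e2]
    simp

/-- The integrand is a finite sum of exponentials with integer frequencies `wt m' + n - wt m`; the
integral keeps frequency zero, which is the selection rule in `mode`, and there `ε` drops out. -/
theorem phiHatForm_etaB (ν₀ ε : ℝ) (k n Q : ℤ) (m : Occ) (w : Db) :
    phiHatForm ν₀ ε k n (etaB Q m) w = ((1 / √(occNormSq m) : ℝ) : ℂ) *
      pair (monomial m 1) (mode (k * ν₀) n (w (Q - k))) := by
  set g := w (Q - k) with hg
  have hz : ∀ x : ℂ, ∀ j : ℤ, Complex.exp (Complex.I * x) ^ j = Complex.exp (Complex.I * j * x) := by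
    intro x j
    rw [← Complex.exp_int_mul]
    congr 1
    ring
  have hmr : ∀ (m : Occ) (a : ℂ), monomial m a = a • monomial m (1 : ℂ) :=
    fun m a => by simp [smul_monomial]
  have hint : ∀ t : ℝ, phiCheck ν₀ k (t - Complex.I * ε) (etaB Q m) w *
      Complex.exp (Complex.I * n * (t - Complex.I * ε)) =
      ∑ m' ∈ g.support, (((1 / √(occNormSq m) : ℝ) : ℂ) * (g.coeff m' *
        vertexForm (k * ν₀) (monomial m 1) (monomial m' 1))) *
        Complex.exp (Complex.I * ((wt m' + n - wt m : ℤ) : ℂ) * (t - Complex.I * ε)) := by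
    intro t
    rw [phiCheck_etaB, ← hz _ n, ← hg]
    generalize hx : (t : ℂ) - Complex.I * ε = x
    have hx0 : Complex.exp (Complex.I * x) ≠ 0 := Complex.exp_ne_zero _
    conv_lhs => rw [g.as_sum]
    simp only [map_sum, dilate_monomial, map_smul, LinearMap.smul_apply, smul_eq_mul,
      Finset.mul_sum, Finset.sum_mul]
    refine Finset.sum_congr rfl fun m' _ => ?_
    rw [← hz, hmr m' (coeff m' g), map_smul, smul_eq_mul, zpow_sub₀ hx0, zpow_add₀ hx0,
      zpow_natCast, zpow_natCast, inv_pow, div_eq_mul_inv]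
    ring
  rw [phiHatForm]
  simp only [hint]
  rw [intervalIntegral.integral_finsetSum]
  · simp only [intervalIntegral.integral_const_mul, integral_exp_int]
    conv_rhs => rw [g.as_sum]
    simp only [map_sum, Finset.mul_sum]
    refine Finset.sum_congr rfl fun m' _ => ?_
    rw [hmr m' (coeff m' g), map_smul, map_smul, pair_mode_monomial, smul_eq_mul]
    have e : (wt m' + n - wt m : ℤ) = 0 ↔ (wt m : ℤ) = wt m' + n := by
      constructor <;> intro <;> linarith
    simp only [e]
    split_ifs <;> ring
  · intro m' _
    refine Continuous.intervalIntegrable ?_ _ _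
    fun_prop

theorem braket_etaB (Q : ℤ) (m : Occ) (u : Db) :
    braket (etaB Q m) u = ((1 / √(occNormSq m) : ℝ) : ℂ) * pair (monomial m 1) (u Q) := by
  rw [etaB, braket_single, map_monomial, Complex.conj_ofReal, pair_monomial, pair_monomial, one_mul]

theorem finsum_braket_etaB (u : Db) : ∑ᶠ b : ℤ × Occ, braket (etaB b.1 b.2) u • etaB b.1 b.2 = u := by
  have hterm : ∀ b : ℤ × Occ, braket (etaB b.1 b.2) u • etaB b.1 b.2 =
      Finsupp.single b.1 (monomial b.2 ((u b.1).coeff b.2)) := by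
    intro b
    rw [braket_etaB, etaB, Finsupp.smul_single, smul_monomial, pair_monomial]
    congr 2
    have h : √(occNormSq b.2) ≠ 0 := (Real.sqrt_pos.mpr (occNormSq_pos _)).ne'
    have h2 : ((1 / √(occNormSq b.2) : ℝ) : ℂ) * ((1 / √(occNormSq b.2) : ℝ) : ℂ) *
        (occNormSq b.2 : ℂ) = 1 := by
      rw [← Complex.ofReal_mul, ← Complex.ofReal_mul, ← Complex.ofReal_one]
      congr 1
      have := Real.mul_self_sqrt (occNormSq_pos b.2).le
      field_simp
      linarith
    rw [smul_eq_mul]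
    linear_combination (coeff b.2 (u b.1)) * h2
  set T : Finset Occ := u.support.biUnion fun Q => (u Q).support
  have hsub : ∀ Q ∈ u.support, (u Q).support ⊆ T := fun Q hQ =>
    Finset.subset_biUnion_of_mem (fun Q => (u Q).support) hQ
  simp only [hterm]
  rw [finsum_eq_sum_of_support_subset (s := u.support ×ˢ T), Finset.sum_product]
  · conv_rhs => rw [← u.sum_single]
    refine Finset.sum_congr rfl fun Q hQ => ?_
    rw [← Finsupp.single_finsetSum]
    congr 1
    conv_rhs => rw [(u Q).as_sum]
    refine (Finset.sum_subset (hsub Q hQ) fun m _ hm => ?_).symm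
    rw [MvPolynomial.notMem_support_iff.mp hm, monomial_zero]
  · intro b hb
    have hb' : coeff b.2 (u b.1) ≠ 0 := by
      intro h0
      exact hb (by simp [h0])
    have h1 : b.1 ∈ u.support := by
      rw [Finsupp.mem_support_iff]
      intro h0
      exact hb' (by simp [h0])
    exact Finset.mem_coe.mpr (Finset.mem_product.mpr
      ⟨h1, hsub _ h1 (MvPolynomial.mem_support_iff.mpr hb')⟩)

/-- The expansion defining `phiHat` is compared term by term with the orthonormal expansion of the
claimed value. -/
theorem phiHat_single (ν₀ ε : ℝ) (k n Q : ℤ) (g : Poly) :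
    phiHat ν₀ ε k n (Finsupp.single Q g) = Finsupp.single (Q + k) (mode (k * ν₀) n g) := by
  rw [← finsum_braket_etaB (Finsupp.single (Q + k) _), phiHat]
  refine finsum_congr fun b => ?_
  rw [phiHatForm_etaB, braket_etaB]
  congr 3
  by_cases h : Q + k = b.1
  · rw [← h, add_sub_cancel_right, Finsupp.single_eq_same, Finsupp.single_eq_same]
  · rw [Finsupp.single_eq_of_ne (Ne.symm h), Finsupp.single_eq_of_ne (by omega), map_zero]

/-! ### The Hamiltonians in a charge sector -/

theorem cc_pos_single (l : ℕ+) (Q : ℤ) (f : Poly) :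
    cc ((l : ℕ) : ℤ) (Finsupp.single Q f) = Finsupp.single Q (lower l f) := by
  rw [cc_pos, inSectors_single]

theorem cc_neg_single (l : ℕ+) (Q : ℤ) (f : Poly) :
    cc (-((l : ℕ) : ℤ)) (Finsupp.single Q f) = Finsupp.single Q (mulX l f) := by
  rw [cc_neg, inSectors_single]

theorem normalOrd_cons_pos {n : ℤ} (h : 0 < n) (L : List ℤ) :
    normalOrd (n :: L) = normalOrd L * cc n := by
  rw [normalOrd, if_pos h]

theorem normalOrd_cons_neg {n : ℤ} (h : n < 0) (L : List ℤ) :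
    normalOrd (n :: L) = cc n * normalOrd L := by
  rw [normalOrd, if_neg (by omega), if_pos h]

/-- The triples of non-zero integers with sum zero, parametrized by the two entries of equal sign,
their sign, and the position of the third entry. -/
def triple : (Bool × Fin 3) × ℕ+ × ℕ+ → ℤ × ℤ × ℤ
  | ((true, 0), a, b) => (-((a + b : ℕ+) : ℕ), (a : ℕ), (b : ℕ))
  | ((true, 1), a, b) => ((a : ℕ), -((a + b : ℕ+) : ℕ), (b : ℕ))
  | ((true, 2), a, b) => ((a : ℕ), (b : ℕ), -((a + b : ℕ+) : ℕ))
  | ((false, 0), a, b) => (((a + b : ℕ+) : ℕ), -(a : ℕ), -(b : ℕ))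
  | ((false, 1), a, b) => (-(a : ℕ), ((a + b : ℕ+) : ℕ), -(b : ℕ))
  | ((false, 2), a, b) => (-(a : ℕ), -(b : ℕ), ((a + b : ℕ+) : ℕ))

theorem triple_mem (p : (Bool × Fin 3) × ℕ+ × ℕ+) :
    (triple p).1 ≠ 0 ∧ (triple p).2.1 ≠ 0 ∧ (triple p).2.2 ≠ 0 ∧
      (triple p).1 + (triple p).2.1 + (triple p).2.2 = 0 := by
  obtain ⟨⟨σ, i⟩, a, b⟩ := p
  have ha := a.pos
  have hb := b.pos
  cases σ <;> fin_cases i <;> simp only [triple, PNat.add_coe] <;> omega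

theorem triple_injective : Function.Injective triple := by
  rintro ⟨⟨σ, i⟩, a, b⟩ ⟨⟨σ', i'⟩, a', b'⟩ h
  have ha := a.pos
  have hb := b.pos
  have ha' := a'.pos
  have hb' := b'.pos
  cases σ <;> cases σ' <;> fin_cases i <;> fin_cases i' <;>
    simp only [triple, PNat.add_coe, Prod.mk.injEq] at h <;>
    first
    | (exfalso; omega)
    | (obtain rfl : a = a' := PNat.eq (by omega)
       obtain rfl : b = b' := PNat.eq (by omega)
       rfl)

theorem exists_triple {x y z : ℤ} (hx : x ≠ 0) (hy : y ≠ 0) (hz : z ≠ 0) (h : x + y + z = 0) :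
    ∃ p, triple p = (x, y, z) := by
  have key : ∀ w : ℤ, w ≠ 0 → ∃ a : ℕ+, w = (a : ℕ) ∨ w = -(a : ℕ) := fun w hw =>
    ⟨⟨w.natAbs, by omega⟩, by simp only [PNat.mk_coe]; omega⟩
  obtain ⟨a, ha⟩ := key x hx
  obtain ⟨b, hb⟩ := key y hy
  obtain ⟨c, hc⟩ := key z hz
  have hpa := a.pos
  have hpb := b.pos
  have hpc := c.pos
  rcases ha with rfl | rfl <;> rcases hb with rfl | rfl <;> rcases hc with rfl | rfl
  · omega
  · refine ⟨((true, 2), a, b), ?_⟩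
    simp only [triple, PNat.add_coe, Nat.cast_add, Prod.mk.injEq, true_and]
    omega
  · refine ⟨((true, 1), a, c), ?_⟩
    simp only [triple, PNat.add_coe, Nat.cast_add, Prod.mk.injEq, true_and, and_true]
    omega
  · refine ⟨((false, 0), b, c), ?_⟩
    simp only [triple, PNat.add_coe, Nat.cast_add, Prod.mk.injEq, and_true]
    omega
  · refine ⟨((true, 0), b, c), ?_⟩
    simp only [triple, PNat.add_coe, Nat.cast_add, Prod.mk.injEq, and_true]
    omega
  · refine ⟨((false, 1), a, c), ?_⟩
    simp only [triple, PNat.add_coe, Nat.cast_add, Prod.mk.injEq, true_and, and_true]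
    omega
  · refine ⟨((false, 2), a, b), ?_⟩
    simp only [triple, PNat.add_coe, Nat.cast_add, Prod.mk.injEq, true_and]
    omega
  · omega

theorem normalOrd_triple_true (i : Fin 3) (a b : ℕ+) (Q : ℤ) (f : Poly) :
    normalOrd [(triple ((true, i), a, b)).1, (triple ((true, i), a, b)).2.1,
      (triple ((true, i), a, b)).2.2] (Finsupp.single Q f) =
      Finsupp.single Q (mulX (a + b) (lower a (lower b f))) := by
  have ha : (0 : ℤ) < (a : ℕ) := by exact_mod_cast a.pos
  have hb : (0 : ℤ) < (b : ℕ) := by exact_mod_cast b.pos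
  have hab : -((a + b : ℕ+) : ℕ) < (0 : ℤ) := by
    have := (a + b).pos
    omega
  fin_cases i <;>
    simp only [triple, normalOrd_cons_pos ha, normalOrd_cons_pos hb, normalOrd_cons_neg hab] <;>
    simp only [normalOrd, Module.End.mul_apply, Module.End.one_apply, cc_pos_single,
      cc_neg_single, lower_comm b a]

theorem normalOrd_triple_false (i : Fin 3) (a b : ℕ+) (Q : ℤ) (f : Poly) :
    normalOrd [(triple ((false, i), a, b)).1, (triple ((false, i), a, b)).2.1,
      (triple ((false, i), a, b)).2.2] (Finsupp.single Q f) =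
      Finsupp.single Q (mulX a (mulX b (lower (a + b) f))) := by
  have ha : -(a : ℕ) < (0 : ℤ) := by have := a.pos; omega
  have hb : -(b : ℕ) < (0 : ℤ) := by have := b.pos; omega
  have hab : (0 : ℤ) < ((a + b : ℕ+) : ℕ) := by exact_mod_cast (a + b).pos
  fin_cases i <;>
    simp only [triple, normalOrd_cons_neg ha, normalOrd_cons_neg hb, normalOrd_cons_pos hab] <;>
    simp only [normalOrd, Module.End.mul_apply, Module.End.one_apply, cc_pos_single,
      cc_neg_single]

/-- Among three nonzero integers with sum zero exactly two share a sign. Normal ordering ignores the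
position of the third, so each of the three positions gives one copy of `cubic`, offsetting the
`1/3` in `ℋ^{ν,3}`. -/
theorem finsum_normalOrd {K : ℕ+} {f : Poly} (hf : Bounded K f) (Q : ℤ) :
    ∑ᶠ p : {p : ℤ × ℤ × ℤ // p.1 ≠ 0 ∧ p.2.1 ≠ 0 ∧ p.2.2 ≠ 0 ∧ p.1 + p.2.1 + p.2.2 = 0},
      normalOrd [p.1.1, p.1.2.1, p.1.2.2] (Finsupp.single Q f) =
      Finsupp.single Q ((3 : ℂ) • cubic K f) := by
  set e : (Bool × Fin 3) × ℕ+ × ℕ+ →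
    {p : ℤ × ℤ × ℤ // p.1 ≠ 0 ∧ p.2.1 ≠ 0 ∧ p.2.2 ≠ 0 ∧ p.1 + p.2.1 + p.2.2 = 0} :=
    fun p => ⟨triple p, triple_mem p⟩ with he
  have hbij : Function.Bijective e := by
    refine ⟨fun p q h => triple_injective (congrArg Subtype.val h), ?_⟩
    rintro ⟨⟨x, y, z⟩, hx, hy, hz, h⟩
    obtain ⟨p, hp⟩ := exists_triple hx hy hz h
    exact ⟨p, Subtype.ext hp⟩
  set G : Bool → ℕ+ × ℕ+ → Poly := fun σ p => if σ then mulX (p.1 + p.2) (lower p.1 (lower p.2 f))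
    else mulX p.1 (mulX p.2 (lower (p.1 + p.2) f)) with hG
  have hG0 : ∀ σ p, p ∉ Finset.Icc 1 K ×ˢ Finset.Icc 1 K → G σ p = 0 := by
    intro σ p hp
    rw [Finset.mem_product, not_and_or] at hp
    have h' := hp.imp lt_of_notMem_Icc_one lt_of_notMem_Icc_one
    have h1 : lower (p.1 + p.2) f = 0 := by
      refine hf _ ?_
      rcases h' with h | h
      · exact h.trans (PNat.lt_add_right _ _)
      · exact h.trans (PNat.lt_add_left _ _)
    have h2 : lower p.1 (lower p.2 f) = 0 := by
      rcases h' with h | h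
      · rw [lower_comm, hf _ h, map_zero]
      · rw [hf _ h, map_zero]
    cases σ <;> simp [hG, h1, h2]
  rw [← finsum_eq_of_bijective e hbij (f := fun p => Finsupp.single Q (G p.1.1 p.2))]
  · rw [finsum_eq_sum_of_support_subset
      (s := Finset.univ ×ˢ (Finset.Icc 1 K ×ˢ Finset.Icc 1 K)), Finset.sum_product,
      ← Finset.univ_product_univ, Finset.sum_product]
    · simp only [Fintype.sum_bool, Finset.sum_const, Finset.card_univ, Fintype.card_fin]
      rw [← smul_add, ← Finset.sum_add_distrib]
      simp only [← Finsupp.single_add, ← Finsupp.single_finsetSum]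
      rw [cubic_apply, ← Finset.sum_product', ← Finsupp.smul_single]
      rw [← Nat.cast_smul_eq_nsmul ℂ 3]
      simp only [hG, Nat.cast_ofNat, if_true, Bool.false_eq_true, if_false]
      congr 3
      funext p
      rw [add_comm]
    · intro p hp
      by_contra hp'
      refine hp ?_
      have : G p.1.1 p.2 = 0 := hG0 _ _ fun h =>
        hp' (Finset.mem_coe.mpr (Finset.mem_product.mpr ⟨Finset.mem_univ _, h⟩))
      simp [this]
  · rintro ⟨⟨σ, i⟩, a, b⟩
    cases σ
    · exact (normalOrd_triple_false i a b Q f).symm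
    · exact (normalOrd_triple_true i a b Q f).symm

theorem H1_single (ν₀ ν : ℝ) (Q : ℤ) (f : Poly) :
    H1 ν₀ ν (Finsupp.single Q f) = ((ν⁻¹ * (ν₀ * Q) : ℝ) : ℂ) • Finsupp.single Q f := by
  rw [H1, chargeQ_single, smul_smul]
  congr 1
  push_cast
  ring

theorem H2_single (ν₀ : ℝ) (Q : ℤ) (f : Poly) :
    H2 ν₀ (Finsupp.single Q f) =
      Finsupp.single Q (energy f + (1 / 2 * (ν₀ * Q : ℂ) ^ 2) • f) := by
  obtain ⟨K, hK⟩ := exists_bounded f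
  rw [H2, finsum_eq_sum_of_support_subset (s := Finset.Icc 1 K)]
  · simp only [chargeQ_single, map_smul, cc_pos_single, cc_neg_single]
    rw [← Finsupp.single_finsetSum, ← hK.energy_eq]
    simp only [Finsupp.single_add, ← Finsupp.smul_single]
    module
  · intro l hl
    by_contra hl'
    refine hl ?_
    have h : cc ((l : ℕ) : ℤ) (Finsupp.single Q f) = 0 := by
      rw [cc_pos_single, hK l (lt_of_notMem_Icc_one hl'), Finsupp.single_zero]
    simp only [h, map_zero]

theorem H3_single (ν₀ ν : ℝ) {K : ℕ+} {f : Poly} (hf : Bounded K f) (Q : ℤ) :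
    H3 ν₀ ν (Finsupp.single Q f) = Finsupp.single Q (ham ν (ν₀ * Q) K f) := by
  rw [H3, finsum_normalOrd hf, finsum_eq_sum_of_support_subset (s := Finset.Icc 1 K)]
  · simp only [chargeQ_single, map_smul, cc_pos_single, cc_neg_single]
    rw [ham_apply, dispersion_apply, hf.energy_eq]
    simp only [Finset.smul_sum, Finsupp.single_add, Finsupp.single_finsetSum,
      Finset.sum_add_distrib, ← Finsupp.smul_single]
    have h1 : ∀ l : ℕ+, (((1 - ν ^ 2) * (l : ℕ) : ℝ) : ℂ) • Finsupp.single Q (mulX l (lower l f)) =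
        (1 - (ν : ℂ) ^ 2) • ((l : ℕ) : ℂ) • (Finsupp.single Q (mulX l (lower l f)) : Db) := by
      intro l
      push_cast
      module
    have h2 : ∀ l : ℕ+, ((2 * ν : ℝ) : ℂ) • ((ν₀ : ℂ) * Q) • Finsupp.single Q (mulX l (lower l f)) =
        (2 * (ν : ℂ) * (ν₀ * Q)) • (Finsupp.single Q (mulX l (lower l f)) : Db) := by
      intro l
      push_cast
      module
    simp only [h1, h2]
    push_cast
    module
  · intro l hl
    by_contra hl'
    refine hl ?_
    have h : cc ((l : ℕ) : ℤ) (Finsupp.single Q f) = 0 := by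
      rw [cc_pos_single, hf l (lt_of_notMem_Icc_one hl'), Finsupp.single_zero]
    simp only [h, map_zero, smul_zero, add_zero]

/-! ### Products of modes on the vacuum -/

/-- The state `φ̂_{μ₁}(n₁) ⋯ φ̂_{μ_K}(n_K) |Q⟩` as a polynomial. -/
def modeState : {K : ℕ} → (Fin K → ℂ) → (Fin K → ℤ) → Poly
  | 0, _, _ => 1
  | _ + 1, μ, n => mode (μ 0) (n 0) (modeState (Fin.tail μ) (Fin.tail n))

theorem modeState_succ {K : ℕ} (μ : Fin (K + 1) → ℂ) (n : Fin (K + 1) → ℤ) :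
    modeState μ n = mode (μ 0) (n 0) (modeState (Fin.tail μ) (Fin.tail n)) := rfl

theorem tail_sub_single_succ {K : ℕ} (n : Fin (K + 1) → ℤ) (l : ℤ) (j : Fin K) :
    Fin.tail (n - Pi.single j.succ l) = Fin.tail n - Pi.single j l := by
  funext i
  simp [Fin.tail, Pi.single_apply]

theorem tail_sub_single_zero {K : ℕ} (n : Fin (K + 1) → ℤ) (l : ℤ) :
    Fin.tail (n - Pi.single 0 l) = Fin.tail n := by
  funext i
  simp [Fin.tail]

theorem lower_modeState {K : ℕ} (μ : Fin K → ℂ) (n : Fin K → ℤ) (l : ℕ+) :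
    lower l (modeState μ n) = ∑ j, μ j • modeState μ (n - Pi.single j ((l : ℕ) : ℤ)) := by
  induction K with
  | zero =>
    have h : lower l (C 1) = 0 := by simp [lower_apply]
    simpa [modeState] using h
  | succ K ih =>
    rw [modeState_succ, lower_mode, ih, Fin.sum_univ_succ, add_comm, map_sum]
    congr 1
    · rw [modeState_succ, tail_sub_single_zero]
      simp
    · refine Finset.sum_congr rfl fun j _ => ?_
      rw [map_smul, modeState_succ, tail_sub_single_succ]
      simp [Fin.tail]

theorem energy_modeState {K : ℕ} (μ : Fin K → ℂ) (n : Fin K → ℤ) :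
    energy (modeState μ n) = (∑ j, (n j : ℂ)) • modeState μ n := by
  induction K with
  | zero => simp [modeState]
  | succ K ih =>
    rw [modeState_succ, energy_mode, ih, map_smul, Fin.sum_univ_succ, ← add_smul, add_comm]
    rfl

theorem exists_modeState_eq_zero {K : ℕ} (μ : Fin K → ℂ) (n : Fin K → ℤ) (k : Fin K) :
    ∃ l₀ : ℤ, ∀ l, l₀ < l → modeState μ (n - Pi.single k l) = 0 := by
  induction K with
  | zero => exact k.elim0
  | succ K ih =>
    refine Fin.cases ?_ (fun k => ?_) k
    · obtain ⟨n₀, h⟩ := exists_mode_eq_zero (μ 0) (modeState (Fin.tail μ) (Fin.tail n))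
      refine ⟨n 0 - n₀, fun l hl => ?_⟩
      rw [modeState_succ, tail_sub_single_zero]
      refine h _ ?_
      simp only [Pi.sub_apply, Pi.single_eq_same]
      omega
    · obtain ⟨l₀, h⟩ := ih (Fin.tail μ) (Fin.tail n) k
      refine ⟨l₀, fun l hl => ?_⟩
      rw [modeState_succ, tail_sub_single_succ, h l hl, map_zero]

theorem shift_zero_succ {K : ℕ} (n : Fin (K + 1) → ℤ) (l : ℕ+) (k : Fin K) :
    shift n l 0 k.succ 0 = n 0 + (l : ℕ) ∧
      Fin.tail (shift n l 0 k.succ) = Fin.tail n - Pi.single k ((l : ℕ) : ℤ) := by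
  refine ⟨by simp [shift, (Fin.succ_ne_zero _).symm], ?_⟩
  funext i
  by_cases h : i = k
  · subst h
    simp [Fin.tail, shift, Fin.succ_ne_zero, sub_eq_add_neg]
  · simp [Fin.tail, shift, Fin.succ_ne_zero, h]

theorem shift_succ_succ {K : ℕ} (n : Fin (K + 1) → ℤ) (l : ℕ+) (j k : Fin K) :
    shift n l j.succ k.succ 0 = n 0 ∧
      Fin.tail (shift n l j.succ k.succ) = shift (Fin.tail n) l j k := by
  refine ⟨by simp [shift, (Fin.succ_ne_zero _).symm], ?_⟩
  funext i
  simp [Fin.tail, shift, Pi.single_apply]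

theorem finite_pnat_of_bound {p : ℕ+ → Prop} (l₀ : ℤ) (h : ∀ l : ℕ+, l₀ < (l : ℕ) → ¬p l) :
    {l | p l}.Finite := by
  refine (Set.finite_Iic l₀.toNat.succPNat).subset fun l hl => ?_
  rw [Set.mem_Iic, ← PNat.coe_le_coe, Nat.succPNat_coe]
  by_contra h'
  exact h l (by omega) hl

/-- Since `j < k`, the factors to the right of `j` see only the lowering of index `k`, and for large
`l` they already give zero. Raising index `j` then acts on the zero state. -/
theorem finite_modeState_shift {K : ℕ} (μ : Fin K → ℂ) (n : Fin K → ℤ) {j k : Fin K} (hjk : j < k) :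
    {l : ℕ+ | modeState μ (shift n l j k) ≠ 0}.Finite := by
  induction K with
  | zero => exact k.elim0
  | succ K ih =>
    obtain ⟨k, rfl⟩ := Fin.exists_succ_eq.mpr (Fin.ne_zero_of_lt hjk)
    revert hjk
    refine Fin.cases (fun _ => ?_) (fun j hjk => ?_) j
    · obtain ⟨l₀, h⟩ := exists_modeState_eq_zero (Fin.tail μ) (Fin.tail n) k
      refine finite_pnat_of_bound l₀ fun l hl => not_not.mpr ?_
      rw [modeState_succ, (shift_zero_succ n l k).2, h _ hl, map_zero]
    · refine (ih (Fin.tail μ) (Fin.tail n) (Fin.succ_lt_succ_iff.mp hjk)).subset fun l hl hl' => ?_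
      refine hl ?_
      rw [modeState_succ, (shift_succ_succ n l j k).2, hl', map_zero]

/-- `∑_{l>0} l η(𝐧 + l (𝐞ⱼ - 𝐞ₖ))`. -/
def shiftSum {K : ℕ} (μ : Fin K → ℂ) (n : Fin K → ℤ) (j k : Fin K) : Poly :=
  ∑ᶠ l : ℕ+, ((l : ℕ) : ℂ) • modeState μ (shift n l j k)

theorem shiftSum_succ_succ {K : ℕ} (μ : Fin (K + 1) → ℂ) (n : Fin (K + 1) → ℤ) {j k : Fin K}
    (hjk : j < k) : shiftSum μ n j.succ k.succ =
      mode (μ 0) (n 0) (shiftSum (Fin.tail μ) (Fin.tail n) j k) := by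
  have h := (mode (μ 0) (n 0)).toAddMonoidHom.map_finsum
    (f := fun l : ℕ+ => ((l : ℕ) : ℂ) • modeState (Fin.tail μ) (shift (Fin.tail n) l j k))
    ((finite_modeState_shift (Fin.tail μ) (Fin.tail n) hjk).subset fun l hl hl' => by
      simp [hl'] at hl)
  rw [shiftSum, shiftSum]
  refine Eq.trans (finsum_congr fun l => ?_) h.symm
  rw [modeState_succ, (shift_succ_succ n l j k).1, (shift_succ_succ n l j k).2]
  exact (map_smul _ _ _).symm

/-- Each `𝔠ₗ` is distributed over the later factors by its commutators, so the leftover of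
`ham_mode` becomes shifts between factor `0` and factors `k + 1`. -/
theorem sum_mode_lower_modeState {K : ℕ} (μ : Fin (K + 1) → ℂ) (n : Fin (K + 1) → ℤ) {B : ℕ+}
    (hB : Bounded B (modeState (Fin.tail μ) (Fin.tail n))) :
    ∑ l ∈ Finset.Icc 1 B, ((l : ℕ) : ℂ) •
      mode (μ 0) (n 0 + (l : ℕ)) (lower l (modeState (Fin.tail μ) (Fin.tail n))) =
      ∑ k : Fin K, μ k.succ • shiftSum μ n 0 k.succ := by
  have h1 : ∀ k : Fin K, (Function.support fun l : ℕ+ =>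
      μ k.succ • ((l : ℕ) : ℂ) • modeState μ (shift n l 0 k.succ)).Finite := fun k =>
    (finite_modeState_shift μ n (Fin.succ_pos k)).subset fun l hl hl' => by simp [hl'] at hl
  rw [← finsum_eq_sum_of_support_subset]
  · simp only [shiftSum, smul_finsum]
    rw [← finsum_sum_comm _ _ fun k _ => h1 k]
    refine finsum_congr fun l => ?_
    rw [lower_modeState, map_sum, Finset.smul_sum]
    refine Finset.sum_congr rfl fun k _ => ?_
    rw [map_smul, smul_comm, modeState_succ, (shift_zero_succ n l k).1, (shift_zero_succ n l k).2]
    rfl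
  · intro l hl
    by_contra hl'
    refine hl ?_
    have h := hB l (lt_of_notMem_Icc_one hl')
    simp only [h, map_zero, smul_zero]

theorem ham_modeState {K : ℕ} {ν : ℂ} (q : ℂ) (μ : Fin K → ℂ) (n : Fin K → ℤ)
    (hμ : ∀ j, μ j ≠ 0) (h : ∀ j, (ν * μ j + 1) * (μ j - ν) = 0) {B : ℕ+}
    (hB : Bounded B (modeState μ n)) :
    ham ν (q + ∑ j, μ j) B (modeState μ n) =
      (∑ j, diagTerm ν (μ j) (q + ∑ i ∈ Finset.Ici j, μ i) (n j) +
        (ν / 3 * q ^ 3 - ν ^ 3 / 12 * q)) • modeState μ n +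
      ∑ j, ∑ k ∈ Finset.Ioi j, (2 * (1 - ν ^ 2) * μ j * μ k) • shiftSum μ n j k := by
  induction K generalizing B with
  | zero =>
    have h3 : ∀ l, lower l (1 : Poly) = 0 := fun l => by
      have : lower l (C 1) = 0 := by simp [lower_apply]
      simpa using this
    simp [modeState, ham_apply, cubic_apply, dispersion_apply, h3]
  | succ K ih =>
    obtain ⟨B₁, hB₁⟩ := exists_bounded (modeState (Fin.tail μ) (Fin.tail n))
    -- One cutoff must cover both the state and its tail before `ham_mode` applies.
    have hle : B ≤ max B B₁ := le_max_left _ _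
    have hB₂ := hB₁.mono (le_max_right B B₁)
    have hIH := ih (Fin.tail μ) (Fin.tail n) (fun j => hμ j.succ) (fun j => h j.succ) hB₂
    have hq : q + ∑ j, μ j = (q + ∑ j, Fin.tail μ j) + μ 0 := by
      rw [Fin.sum_univ_succ]
      simp only [Fin.tail]
      ring
    have hIci : ∀ j : Fin K, ∑ i ∈ Finset.Ici j.succ, μ i = ∑ i ∈ Finset.Ici j, Fin.tail μ i := by
      intro j
      rw [← Fin.map_succEmb_Ici, Finset.sum_map]
      rfl
    have hIci0 : ∑ i ∈ Finset.Ici (0 : Fin (K + 1)), μ i = ∑ i, μ i := by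
      congr 1
      ext i
      simp
    rw [← hB.ham_eq hle, hq, modeState_succ,
      ham_mode (hμ 0) (h 0) _ hB₂ (n 0) (hB.mono hle), hIH, sum_mode_lower_modeState μ n hB₂,
      ← hq, Fin.sum_univ_succ (n := K) (f := fun j => diagTerm ν (μ j) _ _), hIci0,
      Fin.sum_univ_succ (n := K) (f := fun j => ∑ k ∈ Finset.Ioi j, _), Fin.sum_Ioi_zero]
    simp only [hIci, Fin.sum_Ioi_succ, map_add, map_smul, map_sum, Finset.smul_sum, smul_smul]
    have hs : ∀ j : Fin K, ∑ k ∈ Finset.Ioi j, (2 * (1 - ν ^ 2) * μ j.succ * μ k.succ) •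
        shiftSum μ n j.succ k.succ = ∑ k ∈ Finset.Ioi j,
        (2 * (1 - ν ^ 2) * Fin.tail μ j * Fin.tail μ k) •
          mode (μ 0) (n 0) (shiftSum (Fin.tail μ) (Fin.tail n) j k) := fun j =>
      Finset.sum_congr rfl fun k hk => by
        rw [shiftSum_succ_succ μ n (Finset.mem_Ioi.mp hk)]
        rfl
    simp only [hs]
    have ht : ∀ j : Fin K, Fin.tail n j = n j.succ ∧ Fin.tail μ j = μ j.succ := fun j => ⟨rfl, rfl⟩
    simp only [(ht _).1, (ht _).2]
    module

theorem foldr_phiHat (ν₀ ε : ℝ) {K : ℕ} (k n : Fin K → ℤ) (Q : ℤ) :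
    (List.finRange K).foldr (fun j v => phiHat ν₀ ε (k j) (n j) v) (ket Q) =
      Finsupp.single (Q + ∑ j, k j) (modeState (fun j => (k j : ℂ) * ν₀) n) := by
  induction K with
  | zero => simp [ket_eq, modeState]
  | succ K ih =>
    have h := ih (Fin.tail k) (Fin.tail n)
    simp only [Fin.tail] at h
    rw [List.finRange_succ, List.foldr_cons, List.foldr_map, h, phiHat_single, Fin.sum_univ_succ, modeState_succ]
    congr 1
    ring

/-! ### Eigenvalues and coefficients -/

/-- The statistics parameters `ν, …, ν, -1/ν, …, -1/ν`. -/
def stat (ν : ℝ) (N M : ℕ) (j : Fin (N + M)) : ℝ := if (j : ℕ) < N then ν else -ν⁻¹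

theorem stat_castAdd (ν : ℝ) (N M : ℕ) (j : Fin N) : stat ν N M (Fin.castAdd M j) = ν := by
  simp [stat]

theorem stat_natAdd (ν : ℝ) (N M : ℕ) (j : Fin M) : stat ν N M (Fin.natAdd N j) = -ν⁻¹ := by
  simp [stat]

theorem sum_stat (ν : ℝ) (N M : ℕ) : ∑ j, stat ν N M j = N * ν - M * ν⁻¹ := by
  simp [Fin.sum_univ_add, stat_castAdd, stat_natAdd, sub_eq_add_neg]

theorem sum_Ici_eq {K : ℕ} (j : Fin K) (F : Fin K → ℝ) :
    ∑ i ∈ Finset.Ici j, F i = ∑ i, if j ≤ i then F i else 0 := by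
  rw [← Finset.sum_filter]
  congr 1
  ext i
  simp

theorem sum_Ici_stat_castAdd (ν : ℝ) (N M : ℕ) (j : Fin N) :
    ∑ i ∈ Finset.Ici (Fin.castAdd M j), stat ν N M i = (N - (j : ℕ)) * ν - M * ν⁻¹ := by
  have h : ∀ i : Fin M, Fin.castAdd M j ≤ Fin.natAdd N i := fun i => by
    rw [Fin.le_def, Fin.val_castAdd, Fin.val_natAdd]
    omega
  have h' : ∀ i : Fin N, Fin.castAdd M j ≤ Fin.castAdd M i ↔ j ≤ i := fun i => Iff.rfl
  rw [sum_Ici_eq, Fin.sum_univ_add]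
  simp only [h, h', if_true, stat_castAdd, stat_natAdd]
  rw [← sum_Ici_eq j fun _ => ν, Finset.sum_const, Finset.sum_const, Fin.card_Ici, Finset.card_univ,
    Fintype.card_fin, nsmul_eq_mul, nsmul_eq_mul, Nat.cast_sub j.isLt.le]
  ring

theorem sum_Ici_stat_natAdd (ν : ℝ) (N M : ℕ) (j : Fin M) :
    ∑ i ∈ Finset.Ici (Fin.natAdd N j), stat ν N M i = -(M - (j : ℕ)) * ν⁻¹ := by
  have h : ∀ i : Fin N, ¬Fin.natAdd N j ≤ Fin.castAdd M i := fun i => by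
    rw [Fin.le_def, Fin.val_castAdd, Fin.val_natAdd]
    omega
  have h' : ∀ i : Fin M, Fin.natAdd N j ≤ Fin.natAdd N i ↔ j ≤ i := fun i => by
    rw [Fin.le_def, Fin.val_natAdd, Fin.val_natAdd, Fin.le_def]
    omega
  rw [sum_Ici_eq, Fin.sum_univ_add]
  simp only [h, h', if_false, stat_natAdd, Finset.sum_const_zero, zero_add]
  rw [← sum_Ici_eq j fun _ => -ν⁻¹, Finset.sum_const, Fin.card_Ici, nsmul_eq_mul,
    Nat.cast_sub j.isLt.le]
  ring

theorem nPlus_castAdd (ν₀ ν : ℝ) (N M : ℕ) (Q : ℤ) (n : Fin (N + M) → ℤ) (j : Fin N) :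
    nPlus ν₀ ν N M Q n (Fin.castAdd M j) = n (Fin.castAdd M j) +
      ν ^ 2 * (N - 1 / 2 - (j : ℕ)) - M + ν * ν₀ * Q := by
  rw [nPlus, if_pos (by simp), Fin.val_castAdd]
  ring

theorem nPlus_natAdd (ν₀ ν : ℝ) (N M : ℕ) (Q : ℤ) (n : Fin (N + M) → ℤ) (j : Fin M) :
    nPlus ν₀ ν N M Q n (Fin.natAdd N j) = n (Fin.natAdd N j) +
      (ν ^ 2)⁻¹ * (M - 1 / 2 - (j : ℕ)) - ν⁻¹ * ν₀ * Q := by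
  rw [nPlus, if_neg (by simp), Fin.val_natAdd]
  push_cast
  ring

theorem sum_pseudomomentum_offset (K : ℕ) : ∑ j : Fin K, ((K : ℝ) - 1 / 2 - (j : ℕ)) = K ^ 2 / 2 := by
  have h : ∀ L : ℕ, ∑ j ∈ Finset.range L, (j : ℝ) = L * (L - 1) / 2 := by
    intro L
    induction L with
    | zero => simp
    | succ L ih => rw [Finset.sum_range_succ, ih]; push_cast; ring
  rw [Finset.sum_sub_distrib, Fin.sum_univ_eq_sum_range (fun j => (j : ℝ)), h]
  simp
  ring

/-- The offsets of the pseudo-momenta sum to the difference between half the square of the final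
charge and that of the initial one. -/
theorem sum_nPlus (ν₀ ν : ℝ) (hν : ν ≠ 0) (N M : ℕ) (Q : ℤ) (n : Fin (N + M) → ℤ) :
    ∑ j, (n j : ℝ) + 1 / 2 * (ν₀ * Q + (N * ν - M * ν⁻¹)) ^ 2 = E2 ν₀ ν N M Q n := by
  rw [E2, Fin.sum_univ_add, Fin.sum_univ_add]
  simp only [nPlus_castAdd, nPlus_natAdd, Finset.sum_add_distrib,
    Finset.sum_sub_distrib (f := fun j => _ + _), ← Finset.mul_sum, sum_pseudomomentum_offset, Finset.sum_const, Finset.card_univ, Fintype.card_fin, nsmul_eq_mul]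
  field_simp
  ring

theorem diagTerm_stat_castAdd (ν₀ : ℝ) {ν : ℝ} (hν : ν ≠ 0) (N M : ℕ) (Q : ℤ)
    (n : Fin (N + M) → ℤ) (j : Fin N) :
    diagTerm ν (stat ν N M (Fin.castAdd M j))
      (ν₀ * Q + ((∑ i ∈ Finset.Ici (Fin.castAdd M j), stat ν N M i : ℝ) : ℂ))
      (n (Fin.castAdd M j)) = ((nPlus ν₀ ν N M Q n (Fin.castAdd M j) ^ 2 : ℝ) : ℂ) := by
  have hν' : (ν : ℂ) ≠ 0 := by exact_mod_cast hν
  rw [diagTerm, sum_Ici_stat_castAdd, nPlus_castAdd, stat_castAdd]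
  push_cast
  field_simp
  ring

theorem diagTerm_stat_natAdd (ν₀ : ℝ) {ν : ℝ} (hν : ν ≠ 0) (N M : ℕ) (Q : ℤ)
    (n : Fin (N + M) → ℤ) (j : Fin M) :
    diagTerm ν (stat ν N M (Fin.natAdd N j))
      (ν₀ * Q + ((∑ i ∈ Finset.Ici (Fin.natAdd N j), stat ν N M i : ℝ) : ℂ))
      (n (Fin.natAdd N j)) = ((-ν ^ 2 * nPlus ν₀ ν N M Q n (Fin.natAdd N j) ^ 2 +
        1 / 12 * (ν ^ 2 - (ν ^ 2)⁻¹) : ℝ) : ℂ) := by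
  have hν' : (ν : ℂ) ≠ 0 := by exact_mod_cast hν
  rw [diagTerm, sum_Ici_stat_natAdd, nPlus_natAdd, stat_natAdd]
  push_cast
  field_simp
  ring

theorem sum_diagTerm_stat (ν₀ : ℝ) {ν : ℝ} (hν : ν ≠ 0) (N M : ℕ) (Q : ℤ)
    (n : Fin (N + M) → ℤ) :
    ∑ j, diagTerm ν (stat ν N M j) (ν₀ * Q + ∑ i ∈ Finset.Ici j, (stat ν N M i : ℂ)) (n j) +
      ((ν : ℂ) / 3 * (ν₀ * Q) ^ 3 - (ν : ℂ) ^ 3 / 12 * (ν₀ * Q)) = (E3 ν₀ ν N M Q n : ℂ) := by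
  simp only [← Complex.ofReal_sum]
  rw [Fin.sum_univ_add]
  simp only [diagTerm_stat_castAdd ν₀ hν, diagTerm_stat_natAdd ν₀ hν]
  simp only [← Complex.ofReal_sum, Finset.sum_add_distrib, ← Finset.mul_sum, Finset.sum_const,
    Finset.card_univ, Fintype.card_fin, nsmul_eq_mul]
  rw [E3]
  push_cast
  ring

/-- The three cases of `γⱼₖ` are one formula in the statistics parameters, which matches the
coefficients in `ham_modeState`. -/
theorem gam_eq {ν : ℝ} (hν : ν ≠ 0) {N M : ℕ} {j k : Fin (N + M)} (hjk : j < k) :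
    gam ν N M j k = (ν ^ 2 - 1) * stat ν N M j * stat ν N M k := by
  have hjk' : (j : ℕ) < k := hjk
  unfold gam stat
  split_ifs <;> first | omega | (field_simp; try ring)

/-- Here `ν = r ν₀` and `1/ν = s ν₀` enter: the integer charge steps `r` and `-s` correspond to the
parameters `ν` and `-1/ν`. -/
theorem eta_eq {ν₀ ν : ℝ} {r s : ℕ} (hν : ν = r * ν₀) (hν' : 1 / ν = s * ν₀) (ε : ℝ) (N M : ℕ)
    (Q : ℤ) (n : Fin (N + M) → ℤ) : eta ν₀ ε r s N M Q n =
      Finsupp.single (Q + (N * r - M * s)) (modeState (fun j => (stat ν N M j : ℂ)) n) := by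
  rw [eta, foldr_phiHat ν₀ ε (fun j : Fin (N + M) => if (j : ℕ) < N then (r : ℤ) else -(s : ℤ)) n Q]
  congr 2
  · simp [Fin.sum_univ_add, sub_eq_add_neg]
  · funext j
    simp only [stat]
    rw [← one_div, hν', hν]
    split_ifs <;> push_cast <;> ring

end Anyon

open Anyon in
theorem corollaryB3 (ν₀ ν : ℝ) (r s : ℕ) (hν₀ : 0 < ν₀) (hr : 0 < r) (hs : 0 < s)
    (hν : ν = r * ν₀) (hν' : 1 / ν = s * ν₀) (ε : ℝ) (hε : 0 < ε)
    (N M : ℕ) (Q : ℤ) (n : Fin (N + M) → ℤ) :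
    Anyon.H1 ν₀ ν (Anyon.eta ν₀ ε r s N M Q n)
        = (Anyon.E1 ν₀ ν N M Q : ℂ) • Anyon.eta ν₀ ε r s N M Q n ∧
    Anyon.H2 ν₀ (Anyon.eta ν₀ ε r s N M Q n)
        = (Anyon.E2 ν₀ ν N M Q n : ℂ) • Anyon.eta ν₀ ε r s N M Q n ∧
    (∀ j k : Fin (N + M), j < k →
      {μ : ℕ+ | Anyon.eta ν₀ ε r s N M Q (Anyon.shift n μ j k) ≠ 0}.Finite) ∧
    Anyon.H3 ν₀ ν (Anyon.eta ν₀ ε r s N M Q n)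
        = (Anyon.E3 ν₀ ν N M Q n : ℂ) • Anyon.eta ν₀ ε r s N M Q n
          - (2 : ℂ) • ∑ j : Fin (N + M), ∑ k ∈ Finset.Ioi j, (Anyon.gam ν N M j k : ℂ) •
              ∑ᶠ μ : ℕ+, ((μ : ℕ) : ℂ) • Anyon.eta ν₀ ε r s N M Q (Anyon.shift n μ j k) := by
  have h0 : ν ≠ 0 := by
    rw [hν]
    have : (0 : ℝ) < r := by exact_mod_cast hr
    positivity
  have h0' : (ν : ℂ) ≠ 0 := by exact_mod_cast h0
  have hq : ν₀ * ((Q + (N * r - M * s) : ℤ) : ℝ) = ν₀ * Q + (N * ν - M * ν⁻¹) := by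
    rw [← one_div, hν', hν]
    push_cast
    ring
  have hqc : (ν₀ : ℂ) * ((Q + (N * r - M * s) : ℤ) : ℂ) = ν₀ * Q + ∑ j, (stat ν N M j : ℂ) := by
    rw [← Complex.ofReal_sum, sum_stat]
    exact_mod_cast congrArg Complex.ofReal hq
  have hfin : ∀ j k : Fin (N + M), j < k →
      {μ : ℕ+ | eta ν₀ ε r s N M Q (shift n μ j k) ≠ 0}.Finite := by
    intro j k hjk
    refine (finite_modeState_shift (fun j => (stat ν N M j : ℂ)) n hjk).subset fun l hl hl' => ?_
    exact hl (by rw [eta_eq hν hν', hl', Finsupp.single_zero])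
  have hshift : ∀ j k : Fin (N + M), j < k →
      ∑ᶠ μ : ℕ+, ((μ : ℕ) : ℂ) • eta ν₀ ε r s N M Q (shift n μ j k) =
        Finsupp.single (Q + (N * r - M * s)) (shiftSum (fun j => (stat ν N M j : ℂ)) n j k) := by
    intro j k hjk
    have h := (Finsupp.singleAddHom (M := Poly) (Q + (N * r - M * s))).map_finsum
      (f := fun l : ℕ+ => ((l : ℕ) : ℂ) • modeState (fun j => (stat ν N M j : ℂ)) (shift n l j k))
      ((finite_modeState_shift (fun j => (stat ν N M j : ℂ)) n hjk).subset fun l hl hl' => by simp [hl'] at hl)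
    rw [shiftSum]
    refine Eq.trans (finsum_congr fun l => ?_) h.symm
    rw [eta_eq hν hν', Finsupp.smul_single]
    rfl
  refine ⟨?_, ?_, hfin, ?_⟩
  · rw [eta_eq hν hν', H1_single, hq]
    congr 2
    rw [E1]
    field_simp
    ring
  · rw [eta_eq hν hν', H2_single, energy_modeState, ← add_smul, ← sum_nPlus ν₀ ν h0, ← hq,
      ← Finsupp.smul_single]
    congr 1
    push_cast
    ring
  · have hst : ∀ j, (stat ν N M j : ℂ) ≠ 0 := by
      intro j
      rw [Complex.ofReal_ne_zero, stat]
      split_ifs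
      · exact h0
      · exact neg_ne_zero.mpr (inv_ne_zero h0)
    -- The two kinds of anyon are the two roots of `(νμ + 1)(μ - ν)`.
    have hst' : ∀ j, ((ν : ℂ) * (stat ν N M j : ℂ) + 1) * ((stat ν N M j : ℂ) - ν) = 0 := by
      intro j
      rw [stat]
      split_ifs
      · ring
      · push_cast
        rw [mul_neg, mul_inv_cancel₀ h0']
        ring
    obtain ⟨B, hB⟩ := exists_bounded (modeState (fun j => (stat ν N M j : ℂ)) n)
    rw [Finset.sum_congr rfl fun j _ => Finset.sum_congr rfl fun k hk => by
      rw [hshift j k (Finset.mem_Ioi.mp hk), gam_eq h0 (Finset.mem_Ioi.mp hk)]]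
    rw [eta_eq hν hν', H3_single ν₀ ν hB, hqc, ham_modeState _ _ n hst hst' hB,
      sum_diagTerm_stat ν₀ h0]
    simp only [Finsupp.smul_single, ← Finsupp.single_finsetSum, ← Finsupp.single_sub]
    congr 1
    rw [sub_eq_add_neg (_ : Poly), ← neg_smul, Finset.smul_sum]
    simp only [Finset.smul_sum, smul_smul]
    congr 1
    refine Finset.sum_congr rfl fun j _ => Finset.sum_congr rfl fun k _ => ?_
    congr 1
    push_cast
    ring
end
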